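/- Let $X$ be a compact connected complex manifold of complex dimension $n$ with a Kähler form $\omega=\sqrt{-1}\sum g_{j\bar k}\,dz^j\wedge d\bar z^k$ for which there is a smooth real function $f$ (a Ricci potential) with $\mathrm{Ric}(\omega)-\omega=\sqrt{-1}\,\partial\bar\partial f$, where $\mathrm{Ric}(\omega)=-\sqrt{-1}\,\partial\bar\partial\log\det(g_{j\bar k})$ (in particular $X$ is Fano and $\omega\in 2\pi c_1(X)$). Let $f$ be normalised by $\int_X e^f\omega^n=\int_X\omega^n=C$. Let $v$ be a holomorphic vector field of type $(1,0)$ on $X$ and let $\theta_v$ be a smooth complex-valued Hamiltonian function of $v$, i.e. $i_v\omega=\sqrt{-1}\,\bar\partial\theta_v$, normalised by $\int_X\theta_v\,\omega^n=0$. Let $h$ be a smooth Hermitian metric on $K_X^{-1}$ with curvature form $\sqrt{-1}F_h=\omega$ (that is, $-\sqrt{-1}\,\partial\bar\partial\log V=\omega$ in local coordinates, where $V=\left|\frac{\partial}{\partial z^1}\wedge\dots\wedge\frac{\partial}{\partial z^n}\right|_h^2$), and let $\Omega_h=V(\sqrt{-1})^n dz^1\wedge d\bar z^1\wedge\dots\wedge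 dz^n\wedge d\bar z^n$ be its volume form. Let $S(\omega)=\sum g^{j\bar k}R_{j\bar k}$ be the scalar curvature, where $\mathrm{Ric}(\omega)=\sqrt{-1}\sum R_{j\bar k}\,dz^j\wedge d\bar z^k$. Then $$\int_X v(f)\,\omega^n=-\int_X\theta_v\,S(\omega)\,\omega^n=C\int_X\theta_v\left(\frac{\Omega_h}{\int_X\Omega_h}-\frac{\omega^n}{C}\right).$$ -/

import Mathlib

open scoped Manifold ContDiff
open MeasureTheory

noncomputable section

namespace FutakiKE

/-- The model space `ℂⁿ`.  Lebesgue measure on it is `dx₁dy₁⋯dxₙdyₙ`. -/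
abbrev Cn (n : ℕ) : Type := Fin n → ℂ

/-- A complex manifold is in particular a smooth real manifold. -/
theorem isManifold_real (n : ℕ) (X : Type*) [TopologicalSpace X] [ChartedSpace (Cn n) X]
    [IsManifold 𝓘(ℂ, Cn n) ω X] : IsManifold 𝓘(ℝ, Cn n) ∞ X := by
  refine isManifold_of_contDiffOn _ _ _ fun e e' he he' => ?_
  have h : ContDiffOn ℂ ω (𝓘(ℂ, Cn n) ∘ (e.symm ≫ₕ e') ∘ 𝓘(ℂ, Cn n).symm)
      (𝓘(ℂ, Cn n).symm ⁻¹' (e.symm ≫ₕ e').source ∩ Set.range 𝓘(ℂ, Cn n)) :=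
    (contDiffGroupoid ω 𝓘(ℂ, Cn n)).compatible he he' |>.1
  exact (ContDiffOn.restrict_scalars ℝ h).of_le le_top

section Tensors

variable {n : ℕ} {X : Type*} [TopologicalSpace X] [ChartedSpace (Cn n) X]

/-- The real tangent space at `x`. -/
abbrev RT (n : ℕ) {X : Type*} [TopologicalSpace X] [ChartedSpace (Cn n) X] (x : X) : Type :=
  TangentSpace 𝓘(ℝ, Cn n) x

/-- The holomorphic tangent space at `x`, a complex vector space.  A complex tangent vector `u`
stands for the vector `½ (u - √-1 J u)` of type `(1,0)`; in coordinates `u = (u¹, …, uⁿ) ∈ ℂⁿ`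
stands for `∑ uʲ ∂/∂zʲ`. -/
abbrev CT (n : ℕ) {X : Type*} [TopologicalSpace X] [ChartedSpace (Cn n) X] (x : X) : Type :=
  TangentSpace 𝓘(ℂ, Cn n) x

/-- The complex tangent space and the real tangent space have the same vectors: both are read in
the preferred chart at `x`. -/
def toRT {x : X} (u : CT n x) : RT n x := (show Cn n from u)

/-- The same identification in the other direction. -/
def toCT {x : X} (u : RT n x) : CT n x := (show Cn n from u)

/-- The complex structure `J` on the real tangent space. -/
def J {x : X} (u : RT n x) : RT n x := toRT (Complex.I • toCT u)

/-- The derivative at `z` of the inverse of the chart `e`, from `ℂⁿ` to the tangent space. -/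
def chartPush (e : OpenPartialHomeomorph X (Cn n)) (z : Cn n) : Cn n →L[ℝ] RT n (e.symm z) :=
  mfderiv 𝓘(ℝ, Cn n) 𝓘(ℝ, Cn n) e.symm z

/-- The coordinate frame `∂/∂x₁, …, ∂/∂xₙ` of the chart `e` at the point with coordinates `z`.
As a complex frame it is `∂/∂z₁, …, ∂/∂zₙ`. -/
def frame (e : OpenPartialHomeomorph X (Cn n)) (z : Cn n) (j : Fin n) : RT n (e.symm z) :=
  chartPush e z (Pi.single j 1)

/-- `∂φ/∂z_j` on `ℂⁿ`. -/
def dz (j : Fin n) (φ : Cn n → ℂ) (z : Cn n) : ℂ :=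
  (1 / 2) * (fderiv ℝ φ z (Pi.single j 1) - Complex.I * fderiv ℝ φ z (Pi.single j Complex.I))

/-- `∂φ/∂z̄_j` on `ℂⁿ`. -/
def dzbar (j : Fin n) (φ : Cn n → ℂ) (z : Cn n) : ℂ :=
  (1 / 2) * (fderiv ℝ φ z (Pi.single j 1) + Complex.I * fderiv ℝ φ z (Pi.single j Complex.I))

/-- The complex Hessian `(∂²φ/∂z_j∂z̄_k)`, the coefficient matrix of `√-1 ∂∂̄φ`.  The coefficient
matrix of a real `(1,1)`-form `√-1 ∑ a_{jk} dz_j ∧ dz̄_k` is `(a_{jk})`. -/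
def ddbar (φ : Cn n → ℂ) (z : Cn n) : Matrix (Fin n) (Fin n) ℂ :=
  Matrix.of fun j k => dz j (dzbar k φ) z

/-- The differential of a complex function, as a real linear map on the real tangent space. -/
def diff (F : X → ℂ) (x : X) : RT n x →L[ℝ] ℂ := mfderiv 𝓘(ℝ, Cn n) 𝓘(ℝ, ℂ) F x

/-- `∂̄F = ½ (dF + √-1 dF ∘ J)`. -/
def dbar (F : X → ℂ) (x : X) (w : RT n x) : ℂ :=
  (1 / 2) * (diff F x w + Complex.I * diff F x (J w))

/-- The derivative `v(F)` of a function along the `(1,0)`-vector field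
`½ (v - √-1 J v)`. -/
def along (v : ∀ x : X, CT n x) (F : X → ℂ) (x : X) : ℂ :=
  (1 / 2) * (diff F x (toRT (v x)) - Complex.I * diff F x (J (toRT (v x))))

/-- A vector field of type `(1,0)` is holomorphic if it is a holomorphic section of the
holomorphic tangent bundle. -/
def IsHolomorphicField [IsManifold 𝓘(ℂ, Cn n) ω X] (v : ∀ x : X, CT n x) : Prop :=
  ContMDiff 𝓘(ℂ, Cn n) 𝓘(ℂ, Cn n).tangent ω
    (fun x => (⟨x, v x⟩ : TangentBundle 𝓘(ℂ, Cn n) X))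

/-- A complex valued form of top degree `2n`, given by its values
`η(u₁, J u₁, …, uₙ, J uₙ)` on the families `u = (u₁, …, uₙ)` of tangent vectors.  These values
determine the form.  The value on the coordinate frame of a chart is the coefficient of
`dx₁ ∧ dy₁ ∧ ⋯ ∧ dxₙ ∧ dyₙ`. -/
abbrev TopForm (n : ℕ) (X : Type*) [TopologicalSpace X] [ChartedSpace (Cn n) X] :=
  ∀ x : X, (Fin n → RT n x) → ℂ

/-- The product of a function and a top form. -/
def fmul (F : X → ℂ) (η : TopForm n X) : TopForm n X := fun x u => F x * η x u

/-- A smooth partition of unity subordinate to the coordinate domains. -/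
def unityPartition (n : ℕ) (X : Type*) [TopologicalSpace X] [ChartedSpace (Cn n) X] [T2Space X]
    [CompactSpace X] [IsManifold 𝓘(ℂ, Cn n) ω X] :
    SmoothPartitionOfUnity X 𝓘(ℝ, Cn n) X Set.univ :=
  haveI := isManifold_real n X
  (SmoothPartitionOfUnity.exists_isSubordinate_chartAt_source 𝓘(ℝ, Cn n) X).choose

/-- It is subordinate to the coordinate domains. -/
theorem unityPartition_isSubordinate (n : ℕ) (X : Type*) [TopologicalSpace X]
    [ChartedSpace (Cn n) X] [T2Space X] [CompactSpace X] [IsManifold 𝓘(ℂ, Cn n) ω X] :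
    (unityPartition n X).IsSubordinate fun x => (chartAt (Cn n) x).source :=
  haveI := isManifold_real n X
  (SmoothPartitionOfUnity.exists_isSubordinate_chartAt_source 𝓘(ℝ, Cn n) X).choose_spec

/-- The integral of a top form over a compact complex manifold, with its complex orientation:
`∑ᵢ ∫ χᵢ η`, each term computed in a chart. -/
def integral [T2Space X] [CompactSpace X] [IsManifold 𝓘(ℂ, Cn n) ω X] (η : TopForm n X) : ℂ :=
  ∑ᶠ i : X, ∫ z in (chartAt (Cn n) i).target,
    (unityPartition n X i ((chartAt (Cn n) i).symm z) : ℂ) *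
      η ((chartAt (Cn n) i).symm z) (frame (chartAt (Cn n) i) z)

end Tensors

/-- The expression of a real two-form in the chart `e`. -/
def localForm {n : ℕ} {X : Type*} [TopologicalSpace X] [ChartedSpace (Cn n) X]
    (α : ∀ x : X, RT n x [⋀^Fin 2]→L[ℝ] ℝ) (e : OpenPartialHomeomorph X (Cn n)) (z : Cn n) :
    Cn n [⋀^Fin 2]→L[ℝ] ℝ :=
  (α (e.symm z)).compContinuousLinearMap (chartPush e z)

/-- A Kähler form: a smooth closed real two-form of type `(1,1)` which is positive. -/
structure KahlerForm (n : ℕ) (X : Type*) [TopologicalSpace X] [ChartedSpace (Cn n) X] where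
  form : ∀ x : X, RT n x [⋀^Fin 2]→L[ℝ] ℝ
  smooth : ∀ e ∈ atlas (Cn n) X, ContDiffOn ℝ ∞ (localForm form e) e.target
  closed : ∀ e ∈ atlas (Cn n) X, ∀ z ∈ e.target, extDeriv (localForm form e) z = 0
  type_one_one : ∀ (x : X) (u w : RT n x), form x ![J u, J w] = form x ![u, w]
  pos : ∀ (x : X) (u : RT n x), u ≠ 0 → 0 < form x ![u, J u]

namespace KahlerForm

variable {n : ℕ} {X : Type*} [TopologicalSpace X] [ChartedSpace (Cn n) X]

/-- For tangent vectors `u₁, …, uₙ` the matrix `-√-1 ω(½(u_j - √-1 J u_j), ½(u_k + √-1 J u_k))`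
of the associated Hermitian form. -/
def hermMatrix (K : KahlerForm n X) (x : X) (u : Fin n → RT n x) :
    Matrix (Fin n) (Fin n) ℂ :=
  Matrix.of fun j k => (1 / 2) *
    ((K.form x ![u j, J (u k)] : ℂ) - Complex.I * (K.form x ![u j, u k] : ℂ))

/-- The matrix `(g_{jk̄})` of the Kähler metric in a chart: `ω = √-1 ∑ g_{jk̄} dz_j ∧ dz̄_k`. -/
def metric (K : KahlerForm n X) (e : OpenPartialHomeomorph X (Cn n)) (z : Cn n) :
    Matrix (Fin n) (Fin n) ℂ :=
  K.hermMatrix (e.symm z) (frame e z)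

/-- The top form `ωⁿ = n! det(g_{jk̄}) (√-1)ⁿ dz₁ ∧ dz̄₁ ∧ ⋯ ∧ dzₙ ∧ dz̄ₙ`, where
`√-1 dz ∧ dz̄ = 2 dx ∧ dy`. -/
def volume (K : KahlerForm n X) : TopForm n X := fun x u =>
  (n.factorial : ℂ) * (K.hermMatrix x u).det * 2 ^ n

/-- The coefficients `R_{jk̄} = -∂²(log det g)/∂z_j∂z̄_k` of the Ricci form
`Ric(ω) = √-1 ∑ R_{jk̄} dz_j ∧ dz̄_k` in a chart. -/
def ricci (K : KahlerForm n X) (e : OpenPartialHomeomorph X (Cn n)) (z : Cn n) :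
    Matrix (Fin n) (Fin n) ℂ :=
  -ddbar (fun y => (Real.log (K.metric e y).det.re : ℂ)) z

/-- The scalar curvature `S(ω) = ∑ g^{jk̄} R_{jk̄}`, computed in the preferred chart at the
point. -/
def scalarCurvature (K : KahlerForm n X) (x : X) : ℂ :=
  ((K.metric (chartAt (Cn n) x) (chartAt (Cn n) x x))⁻¹ *
    K.ricci (chartAt (Cn n) x) (chartAt (Cn n) x x)).trace

/-- `f` is a Ricci potential: a smooth real function with `Ric(ω) - ω = √-1 ∂∂̄ f`. -/
def IsRicciPotential (K : KahlerForm n X) (f : X → ℝ) : Prop :=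
  ContMDiff 𝓘(ℝ, Cn n) 𝓘(ℝ, ℝ) ∞ f ∧
    ∀ e ∈ atlas (Cn n) X, ∀ z ∈ e.target,
      K.ricci e z - K.metric e z = ddbar (fun y => (f (e.symm y) : ℂ)) z

/-- The contraction `i_v ω` of the Kähler form with the `(1,0)`-vector field
`½ (v - √-1 J v)`. -/
def contract (K : KahlerForm n X) (v : ∀ x : X, CT n x) (x : X) (w : RT n x) : ℂ :=
  (1 / 2) * ((K.form x ![toRT (v x), w] : ℂ) -
    Complex.I * (K.form x ![J (toRT (v x)), w] : ℂ))

/-- `θ` is a Hamiltonian function of `v`: it is smooth and `i_v ω = √-1 ∂̄θ`. -/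
def IsHamiltonian (K : KahlerForm n X) (v : ∀ x : X, CT n x) (θ : X → ℂ) : Prop :=
  ContMDiff 𝓘(ℝ, Cn n) 𝓘(ℝ, ℂ) ∞ θ ∧
    ∀ (x : X) (w : RT n x), K.contract v x w = Complex.I * dbar θ x w

end KahlerForm

section Anticanonical

variable {n : ℕ} {X : Type*} [TopologicalSpace X] [ChartedSpace (Cn n) X]

/-- The fibre at `x` of the anticanonical bundle `K_X⁻¹ = Λⁿ T^{1,0}X`. -/
abbrev Anticanonical (n : ℕ) {X : Type*} [TopologicalSpace X] [ChartedSpace (Cn n) X] (x : X) :=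
  ↥(⋀[ℂ]^n (CT n x))

/-- The element `u₁ ∧ ⋯ ∧ uₙ` of the anticanonical line. -/
def wedge {x : X} (u : Fin n → RT n x) : Anticanonical n x :=
  exteriorPower.ιMulti ℂ n fun j => toCT (u j)

/-- A smooth Hermitian metric on the anticanonical bundle. -/
structure AnticanonicalMetric (n : ℕ) (X : Type*) [TopologicalSpace X]
    [ChartedSpace (Cn n) X] where
  inner : ∀ x : X, Anticanonical n x →ₗ⋆[ℂ] Anticanonical n x →ₗ[ℂ] ℂ
  conj_symm : ∀ (x : X) (s t : Anticanonical n x), star (inner x s t) = inner x t s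
  pos : ∀ (x : X) (s : Anticanonical n x), s ≠ 0 → 0 < (inner x s s).re
  smooth : ∀ e ∈ atlas (Cn n) X,
    ContDiffOn ℝ ∞ (fun z => inner (e.symm z) (wedge (frame e z)) (wedge (frame e z))) e.target

namespace AnticanonicalMetric

/-- The function `V = |∂/∂z₁ ∧ ⋯ ∧ ∂/∂zₙ|²_h` in a chart. -/
def weight (h : AnticanonicalMetric n X) (e : OpenPartialHomeomorph X (Cn n)) (z : Cn n) : ℝ :=
  (h.inner (e.symm z) (wedge (frame e z)) (wedge (frame e z))).re

/-- The coefficients `-∂²(log V)/∂z_j∂z̄_k` of the real curvature form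
`√-1 F_h = -√-1 ∂∂̄ log V` of the Chern connection of `h`. -/
def curvature (h : AnticanonicalMetric n X) (e : OpenPartialHomeomorph X (Cn n)) (z : Cn n) :
    Matrix (Fin n) (Fin n) ℂ :=
  -ddbar (fun y => (Real.log (h.weight e y) : ℂ)) z

/-- The curvature form `√-1 F_h` is the Kähler form, that is, `F_h = -√-1 ω`. -/
def HasCurvature (h : AnticanonicalMetric n X) (K : KahlerForm n X) : Prop :=
  ∀ e ∈ atlas (Cn n) X, ∀ z ∈ e.target, h.curvature e z = K.metric e z

/-- The volume form `Ω_h = V (√-1)ⁿ dz₁ ∧ dz̄₁ ∧ ⋯ ∧ dzₙ ∧ dz̄ₙ` of `h`. -/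
def volume (h : AnticanonicalMetric n X) : TopForm n X := fun x u =>
  h.inner x (wedge u) (wedge u) * 2 ^ n

end AnticanonicalMetric

end Anticanonical

end FutakiKE

end

/-!
# The Futaki invariant of a Fano manifold in three forms

Write `Δ = ∑ g^{jk̄} ∂_j ∂_{k̄}` and `⟨∂F, ∂̄G⟩ = ∑ g^{jk̄} ∂_j F ∂_{k̄} G`.  Since `ω` is closed, the
matrix `det g · g⁻¹` is divergence free in every chart (`sum_wirtinger_det_mul_inv`), and a
partition of unity turns this into Green's formula
`∫ F ΔG ωⁿ = -∫ ⟨∂F, ∂̄G⟩ ωⁿ = -∫ ⟨∂G, ∂̄F⟩ ωⁿ` (`KahlerForm.volIntegral_mul_laplacian` and its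
primed version).  The Hamiltonian equation says `v(F) = ⟨∂F, ∂̄θ⟩`
(`KahlerForm.along_eq_pairing`).

The first identity follows at once: the trace of the equation for the Ricci potential gives
`S(ω) = n + Δf`, so that `∫ θ S(ω) ωⁿ = ∫ θ Δf ωⁿ = -∫ v(f) ωⁿ`.

For the second identity, `∂̄` of `Δθ + θ + v(f)` is the contraction of `v` with
`-Ric(ω) + ω + √-1 ∂∂̄f = 0`, because `v` is holomorphic.  By the maximum principle
`Δθ + θ + v(f)` is a constant `c` (`KahlerForm.exists_laplacian_add_eq_const`).  Integration
against `ωⁿ` gives `∫ v(f) ωⁿ = c ∫ ωⁿ`.  Integration against `e^f ωⁿ` gives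
`∫ θ e^f ωⁿ = c ∫ e^f ωⁿ`, since `∫ e^f Δθ ωⁿ = -∫ v(e^f) ωⁿ = -∫ e^f v(f) ωⁿ`.  The
normalisation of `f` makes the two right hand sides equal.

It remains to see that `Ω_h` is a constant multiple of `e^f ωⁿ`
(`AnticanonicalMetric.exists_volume_frame_eq`).  The function `log (V / det g) - f` is globally
defined, since `V` and `det g` change by the same factor `|det ∂Φ|²` between charts, and its complex
Hessian is `-g + R - (R - g) = 0`.  A real function `u` with `∂∂̄u = 0` has `∫ ⟨∂u, ∂̄u⟩ ωⁿ = 0` by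
Green's formula, so `∂u = 0` and `u` is constant (`KahlerForm.exists_eq_const_of_ddbar_eq_zero`).
-/

noncomputable section

namespace FutakiKE

/-! ### Wirtinger derivatives -/

section LocalCalculus

variable {n : ℕ}

/-- The operator `½ (∂/∂x_j + s ∂/∂y_j)` on complex functions on `ℂⁿ`.  It is `∂/∂z_j` for
`s = -√-1` and `∂/∂z̄_j` for `s = √-1`; the rules of calculus common to both are stated for all
`s`. -/
def wirtinger (s : ℂ) (j : Fin n) (φ : Cn n → ℂ) (z : Cn n) : ℂ :=
  (1 / 2) * (fderiv ℝ φ z (Pi.single j 1) + s * fderiv ℝ φ z (Pi.single j Complex.I))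

theorem dz_eq_wirtinger (j : Fin n) (φ : Cn n → ℂ) : dz j φ = wirtinger (-Complex.I) j φ := by
  ext z; simp only [dz, wirtinger]; ring

theorem dzbar_eq_wirtinger (j : Fin n) (φ : Cn n → ℂ) : dzbar j φ = wirtinger Complex.I j φ := rfl

theorem wirtinger_congr {s : ℂ} {j : Fin n} {φ ψ : Cn n → ℂ} {z : Cn n} (h : φ =ᶠ[nhds z] ψ) :
    wirtinger s j φ z = wirtinger s j ψ z := by
  simp only [wirtinger, h.fderiv_eq]

theorem wirtinger_congr_of_eqOn {s : ℂ} {j : Fin n} {φ ψ : Cn n → ℂ} {U : Set (Cn n)}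
    (hU : IsOpen U) (h : Set.EqOn φ ψ U) {z : Cn n} (hz : z ∈ U) :
    wirtinger s j φ z = wirtinger s j ψ z :=
  wirtinger_congr (h.eventuallyEq_of_mem (hU.mem_nhds hz))

theorem wirtinger_const (s : ℂ) (j : Fin n) (c : ℂ) (z : Cn n) :
    wirtinger s j (fun _ => c) z = 0 := by
  simp [wirtinger]

theorem wirtinger_add {s : ℂ} {j : Fin n} {φ ψ : Cn n → ℂ} {z : Cn n}
    (hφ : DifferentiableAt ℝ φ z) (hψ : DifferentiableAt ℝ ψ z) :
    wirtinger s j (fun y => φ y + ψ y) z = wirtinger s j φ z + wirtinger s j ψ z := by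
  simp only [wirtinger, fderiv_fun_add hφ hψ, add_apply]; ring

theorem wirtinger_sub {s : ℂ} {j : Fin n} {φ ψ : Cn n → ℂ} {z : Cn n}
    (hφ : DifferentiableAt ℝ φ z) (hψ : DifferentiableAt ℝ ψ z) :
    wirtinger s j (fun y => φ y - ψ y) z = wirtinger s j φ z - wirtinger s j ψ z := by
  simp only [wirtinger, fderiv_fun_sub hφ hψ, sub_apply]; ring

theorem wirtinger_mul {s : ℂ} {j : Fin n} {φ ψ : Cn n → ℂ} {z : Cn n}
    (hφ : DifferentiableAt ℝ φ z) (hψ : DifferentiableAt ℝ ψ z) :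
    wirtinger s j (fun y => φ y * ψ y) z =
      wirtinger s j φ z * ψ z + φ z * wirtinger s j ψ z := by
  simp only [wirtinger, fderiv_fun_mul hφ hψ, add_apply,
    smul_apply, smul_eq_mul]; ring

theorem wirtinger_sum {ι : Type*} {s : ℂ} {j : Fin n} {t : Finset ι} {φ : ι → Cn n → ℂ} {z : Cn n}
    (hφ : ∀ i ∈ t, DifferentiableAt ℝ (φ i) z) :
    wirtinger s j (fun y => ∑ i ∈ t, φ i y) z = ∑ i ∈ t, wirtinger s j (φ i) z := by
  simp only [wirtinger, fderiv_fun_sum hφ, sum_apply, Finset.mul_sum,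
    ← Finset.sum_add_distrib]

theorem wirtinger_prod {ι : Type*} [DecidableEq ι] {s : ℂ} {j : Fin n} {t : Finset ι}
    {φ : ι → Cn n → ℂ} {z : Cn n} (hφ : ∀ i ∈ t, DifferentiableAt ℝ (φ i) z) :
    wirtinger s j (fun y => ∏ i ∈ t, φ i y) z =
      ∑ i ∈ t, (∏ k ∈ t.erase i, φ k z) * wirtinger s j (φ i) z := by
  simp only [wirtinger, fderiv_finsetProd hφ, sum_apply,
    smul_apply, smul_eq_mul, Finset.mul_sum, ← Finset.sum_add_distrib]
  exact Finset.sum_congr rfl fun i _ => by ring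

theorem wirtinger_cexp {s : ℂ} {j : Fin n} {φ : Cn n → ℂ} {z : Cn n}
    (hφ : DifferentiableAt ℝ φ z) :
    wirtinger s j (fun y => Complex.exp (φ y)) z = Complex.exp (φ z) * wirtinger s j φ z := by
  have h : HasFDerivAt (fun y => Complex.exp (φ y)) (Complex.exp (φ z) • fderiv ℝ φ z) z :=
    hφ.hasFDerivAt.cexp
  simp only [wirtinger, h.fderiv, smul_apply, smul_eq_mul]; ring

theorem contDiffOn_wirtinger {s : ℂ} {j : Fin n} {φ : Cn n → ℂ} {U : Set (Cn n)} (hU : IsOpen U)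
    (hφ : ContDiffOn ℝ ∞ φ U) : ContDiffOn ℝ ∞ (wirtinger s j φ) U := by
  have h : ContDiffOn ℝ ∞ (fderiv ℝ φ) U := hφ.fderiv_of_isOpen hU (by simp)
  exact contDiffOn_const.mul ((h.clm_apply contDiffOn_const).add
    (contDiffOn_const.mul (h.clm_apply contDiffOn_const)))

/-- Symmetry of second derivatives. -/
theorem wirtinger_comm {s t : ℂ} {j k : Fin n} {φ : Cn n → ℂ} {U : Set (Cn n)} (hU : IsOpen U)
    (hφ : ContDiffOn ℝ ∞ φ U) {z : Cn n} (hz : z ∈ U) :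
    wirtinger s j (wirtinger t k φ) z = wirtinger t k (wirtinger s j φ) z := by
  have hd : DifferentiableAt ℝ (fderiv ℝ φ) z :=
    ((hφ.fderiv_of_isOpen hU (m := ∞) (by simp)).contDiffAt (hU.mem_nhds hz)).differentiableAt
      (by simp)
  have hsym : IsSymmSndFDerivAt ℝ φ z :=
    (hφ.contDiffAt (hU.mem_nhds hz)).isSymmSndFDerivAt (by
      rw [minSmoothness_of_isRCLikeNormedField]; exact ENat.LEInfty.out)
  have key (s : ℂ) (j : Fin n) (w : Cn n) : fderiv ℝ (wirtinger s j φ) z w =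
      (1 / 2) * (fderiv ℝ (fderiv ℝ φ) z w (Pi.single j 1) +
        s * fderiv ℝ (fderiv ℝ φ) z w (Pi.single j Complex.I)) := by
    have h (a : Cn n) : HasFDerivAt (fun y => fderiv ℝ φ y a) _ z :=
      hd.hasFDerivAt.clm_apply (hasFDerivAt_const a z)
    have := ((h (Pi.single j 1)).add
      ((h (Pi.single j Complex.I)).const_mul s)).const_mul (1 / 2 : ℂ)
    have h2 : fderiv ℝ (wirtinger s j φ) z = _ := this.fderiv
    rw [h2]; simp; ring
  rw [wirtinger, wirtinger, key, key, key, key, hsym.eq (Pi.single j 1) (Pi.single k 1),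
    hsym.eq (Pi.single j 1) (Pi.single k Complex.I),
    hsym.eq (Pi.single j Complex.I) (Pi.single k 1),
    hsym.eq (Pi.single j Complex.I) (Pi.single k Complex.I)]
  ring

theorem dzbar_eq_zero_of_differentiableAt {φ : Cn n → ℂ} {z : Cn n}
    (hφ : DifferentiableAt ℂ φ z) (j : Fin n) : dzbar j φ z = 0 := by
  have h : (Pi.single j Complex.I : Cn n) = Complex.I • Pi.single j 1 := by
    rw [← Pi.single_smul]; simp
  rw [dzbar, hφ.fderiv_restrictScalars ℝ, h]
  simp only [ContinuousLinearMap.coe_restrictScalars', map_smul, smul_eq_mul]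
  linear_combination (1 / 2 * (fderiv ℂ φ z) (Pi.single j 1)) * Complex.I_mul_I

/-- Cauchy–Riemann: a differentiable function annihilated by all `∂/∂z̄_j` is holomorphic. -/
theorem differentiableAt_of_dzbar_eq_zero {φ : Cn n → ℂ} {z : Cn n}
    (hφ : DifferentiableAt ℝ φ z) (h : ∀ j, dzbar j φ z = 0) : DifferentiableAt ℂ φ z := by
  have hI : ∀ w : Cn n, fderiv ℝ φ z (Complex.I • w) = Complex.I * fderiv ℝ φ z w := by
    have hb : ∀ j, fderiv ℝ φ z (Pi.single j Complex.I) =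
        Complex.I * fderiv ℝ φ z (Pi.single j 1) := fun j => by
      have := h j
      rw [dzbar] at this
      linear_combination (-2 * Complex.I) * this + fderiv ℝ φ z (Pi.single j Complex.I) *
        Complex.I_mul_I
    have hs : ∀ (j : Fin n) (a : ℂ), (Pi.single j a : Cn n) =
        a.re • (Pi.single j 1 : Cn n) + a.im • (Pi.single j Complex.I : Cn n) := fun j a => by
      rw [← Pi.single_smul, ← Pi.single_smul, ← Pi.single_add]
      congr 1
      apply Complex.ext <;> simp
    intro w
    have hw : w = ∑ j, Pi.single j (w j) := (Finset.univ_sum_single w).symm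
    have hw' : Complex.I • w = ∑ j, Pi.single j (Complex.I * w j) :=
      (Finset.univ_sum_single (Complex.I • w)).symm
    rw [hw']
    conv_rhs => rw [hw]
    rw [map_sum, map_sum, Finset.mul_sum]
    refine Finset.sum_congr rfl fun j _ => ?_
    rw [hs j (w j), hs j (Complex.I * w j)]
    simp only [map_add, map_smul, hb, Complex.real_smul, Complex.mul_re, Complex.mul_im,
      Complex.I_re, Complex.I_im]
    push_cast
    linear_combination (-(w j).im * fderiv ℝ φ z (Pi.single j 1)) * Complex.I_mul_I
  let L : Cn n →ₗ[ℂ] ℂ :=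
    { toFun := fderiv ℝ φ z
      map_add' := map_add _
      map_smul' := fun c w => by
        have : c • w = c.re • w + c.im • (Complex.I • w) := by
          ext j; simp only [Pi.smul_apply, Pi.add_apply, smul_eq_mul, Complex.real_smul]
          rw [← mul_assoc, ← add_mul, Complex.re_add_im]
        rw [this, map_add, map_smul, map_smul, hI]
        simp only [Complex.real_smul, smul_eq_mul, RingHom.id_apply]
        rw [← mul_assoc, ← add_mul, Complex.re_add_im] }
  exact (differentiableAt_iff_restrictScalars ℝ hφ).2
    ⟨L.toContinuousLinearMap, by ext w; rfl⟩

/-- The conjugate of a holomorphic function is antiholomorphic. -/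
theorem dz_eq_zero_of_conj {φ : Cn n → ℂ} {z : Cn n} (hφ : DifferentiableAt ℂ φ z) (j : Fin n) :
    dz j (fun y => star (φ y)) z = 0 := by
  have h1 : DifferentiableAt ℝ φ z := hφ.restrictScalars ℝ
  have h2 : HasFDerivAt (fun y => star (φ y)) _ z :=
    (Complex.conjCLE.toContinuousLinearMap.hasFDerivAt.comp z h1.hasFDerivAt)
  have := dzbar_eq_zero_of_differentiableAt hφ j
  rw [dzbar] at this
  rw [dz, h2.fderiv]
  simp only [ContinuousLinearMap.comp_apply, ContinuousLinearEquiv.coe_coe, Complex.conjCLE_apply]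
  have h3 := congrArg (starRingEnd ℂ) this
  simpa [sub_eq_add_neg] using h3

/-- For a real function `∂̄` is the conjugate of `∂`. -/
theorem dzbar_ofReal (φ : Cn n → ℝ) {z : Cn n} (hφ : DifferentiableAt ℝ (fun y => (φ y : ℂ)) z)
    (j : Fin n) : dzbar j (fun y => (φ y : ℂ)) z = star (dz j (fun y => (φ y : ℂ)) z) := by
  have h1 : DifferentiableAt ℝ φ z := Complex.reCLM.differentiableAt.comp z hφ
  have h2 : HasFDerivAt (fun y => (φ y : ℂ)) _ z :=
    (Complex.ofRealCLM.hasFDerivAt.comp z h1.hasFDerivAt)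
  rw [dz, dzbar, h2.fderiv]
  simp

end LocalCalculus

/-! ### Determinants, Jacobian matrices and the complex Hessian -/

section MatrixCalculus

variable {n : ℕ}

/-- Entrywise application of `wirtinger`. -/
def wirtingerMatrix (s : ℂ) (m : Fin n) (g : Cn n → Matrix (Fin n) (Fin n) ℂ) (z : Cn n) :
    Matrix (Fin n) (Fin n) ℂ :=
  Matrix.of fun j k => wirtinger s m (fun y => g y j k) z

theorem contDiffOn_det {g : Cn n → Matrix (Fin n) (Fin n) ℂ} {U : Set (Cn n)}
    (hg : ∀ j k, ContDiffOn ℝ ∞ (fun y => g y j k) U) :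
    ContDiffOn ℝ ∞ (fun y => (g y).det) U := by
  simp only [Matrix.det_apply, Units.smul_def, zsmul_eq_mul]
  exact ContDiffOn.sum fun σ _ => contDiffOn_const.mul (contDiffOn_prod fun i _ => hg _ _)

theorem contDiffOn_adjugate {g : Cn n → Matrix (Fin n) (Fin n) ℂ} {U : Set (Cn n)}
    (hg : ∀ j k, ContDiffOn ℝ ∞ (fun y => g y j k) U) (j k : Fin n) :
    ContDiffOn ℝ ∞ (fun y => (g y).adjugate j k) U := by
  simp only [Matrix.adjugate_apply]
  refine contDiffOn_det fun a b => ?_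
  simp only [Matrix.updateRow_apply]
  split_ifs
  · exact contDiffOn_const
  · exact hg _ _

theorem contDiffOn_matrix_inv {g : Cn n → Matrix (Fin n) (Fin n) ℂ} {U : Set (Cn n)}
    (hg : ∀ j k, ContDiffOn ℝ ∞ (fun y => g y j k) U) (hdet : ∀ y ∈ U, (g y).det ≠ 0)
    (j k : Fin n) : ContDiffOn ℝ ∞ (fun y => (g y)⁻¹ j k) U := by
  simp only [Matrix.inv_def, Matrix.smul_apply, Ring.inverse_eq_inv', smul_eq_mul]
  exact ((contDiffOn_det hg).inv hdet).mul (contDiffOn_adjugate hg j k)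

/-- Jacobi's formula. -/
theorem wirtinger_det {s : ℂ} {m : Fin n} {g : Cn n → Matrix (Fin n) (Fin n) ℂ} {z : Cn n}
    (hg : ∀ j k, DifferentiableAt ℝ (fun y => g y j k) z) :
    wirtinger s m (fun y => (g y).det) z =
      ((g z).adjugate * wirtingerMatrix s m g z).trace := by
  have hp (σ : Equiv.Perm (Fin n)) : DifferentiableAt ℝ (fun y => ∏ i, g y (σ i) i) z :=
    (HasFDerivAt.finsetProd fun i _ => (hg (σ i) i).hasFDerivAt).differentiableAt
  simp only [Matrix.det_apply, Units.smul_def, zsmul_eq_mul]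
  rw [wirtinger_sum fun σ _ => (differentiableAt_const _).fun_mul
    (hp σ)]
  have h1 (σ : Equiv.Perm (Fin n)) : wirtinger s m
      (fun y => (((Equiv.Perm.sign σ : ℤˣ) : ℤ) : ℂ) * ∏ i, g y (σ i) i) z =
      ∑ i, (((Equiv.Perm.sign σ : ℤˣ) : ℤ) : ℂ) *
        ∏ k, (g z).updateCol i (fun j => wirtingerMatrix s m g z j i) (σ k) k := by
    rw [wirtinger_mul (differentiableAt_const _)
      (hp σ), wirtinger_const,
      wirtinger_prod fun i _ => hg _ _, zero_mul, zero_add, Finset.mul_sum]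
    refine Finset.sum_congr rfl fun i _ => ?_
    rw [← Finset.prod_erase_mul _ _ (Finset.mem_univ i), Matrix.updateCol_self]
    congr 2
    refine Finset.prod_congr rfl fun k hk => ?_
    rw [Matrix.updateCol_ne (Finset.ne_of_mem_erase hk)]
  simp only [h1]
  rw [Finset.sum_comm, Matrix.trace]
  refine Finset.sum_congr rfl fun i _ => ?_
  have h2 := Matrix.det_apply' ((g z).updateCol i (fun j => wirtingerMatrix s m g z j i))
  rw [← h2, ← Matrix.cramer_apply, Matrix.cramer_eq_adjugate_mulVec]
  rfl

/-- Jacobi's formula for an invertible matrix: `∂ det g = det g · tr (g⁻¹ ∂g)`. -/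
theorem wirtinger_det_eq_mul_trace {s : ℂ} {m : Fin n} {g : Cn n → Matrix (Fin n) (Fin n) ℂ}
    {z : Cn n} (hg : ∀ j k, DifferentiableAt ℝ (fun y => g y j k) z) (hdet : (g z).det ≠ 0) :
    wirtinger s m (fun y => (g y).det) z =
      (g z).det * ((g z)⁻¹ * wirtingerMatrix s m g z).trace := by
  rw [wirtinger_det hg, Matrix.inv_def, Matrix.smul_mul, Matrix.trace_smul, Ring.inverse_eq_inv',
    smul_eq_mul, mul_inv_cancel_left₀ hdet]

/-- The derivative of the inverse matrix is `-g⁻¹ (∂g) g⁻¹`. -/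
theorem wirtingerMatrix_inv {s : ℂ} {m : Fin n} {g : Cn n → Matrix (Fin n) (Fin n) ℂ}
    {U : Set (Cn n)} (hU : IsOpen U) (hg : ∀ j k, ContDiffOn ℝ ∞ (fun y => g y j k) U)
    (hdet : ∀ y ∈ U, (g y).det ≠ 0) {z : Cn n} (hz : z ∈ U) :
    wirtingerMatrix s m (fun y => (g y)⁻¹) z =
      -((g z)⁻¹ * wirtingerMatrix s m g z * (g z)⁻¹) := by
  have hd {φ : Cn n → ℂ} (h : ContDiffOn ℝ ∞ φ U) : DifferentiableAt ℝ φ z :=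
    (h.contDiffAt (hU.mem_nhds hz)).differentiableAt (by simp)
  have hgi := contDiffOn_matrix_inv hg hdet
  have hu : ∀ y ∈ U, IsUnit (g y).det := fun y hy => (hdet y hy).isUnit
  -- differentiate `g⁻¹ g = 1`
  have h : wirtingerMatrix s m (fun y => (g y)⁻¹) z * g z +
      (g z)⁻¹ * wirtingerMatrix s m g z = 0 := by
    ext j k
    have h0 : wirtinger s m (fun y => ∑ l, (g y)⁻¹ j l * g y l k) z = 0 := by
      rw [wirtinger_congr_of_eqOn (ψ := fun _ => (1 : Matrix (Fin n) (Fin n) ℂ) j k) hU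
        (fun y hy => ?_) hz, wirtinger_const]
      rw [← Matrix.nonsing_inv_mul _ (hu y hy), Matrix.mul_apply]
    rw [wirtinger_sum fun l _ => (hd (hgi j l)).fun_mul (hd (hg l k))] at h0
    rw [Matrix.add_apply, Matrix.mul_apply, Matrix.mul_apply, ← Finset.sum_add_distrib,
      Matrix.zero_apply, ← h0]
    refine Finset.sum_congr rfl fun l _ => ?_
    rw [wirtinger_mul (hd (hgi j l)) (hd (hg l k))]
    rfl
  have h2 := congrArg (· * (g z)⁻¹) h
  simp only [add_mul, zero_mul, Matrix.mul_assoc, Matrix.mul_nonsing_inv _ (hu z hz),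
    Matrix.mul_one] at h2
  rw [eq_neg_iff_add_eq_zero, Matrix.mul_assoc]
  exact h2

/-- If `∂g_{jk}/∂z_m` is symmetric in `m` and `j` then the rows of `det g · g⁻¹` are divergence
free. -/
theorem sum_wirtinger_det_mul_inv {s : ℂ} {g : Cn n → Matrix (Fin n) (Fin n) ℂ}
    {U : Set (Cn n)} (hU : IsOpen U) (hg : ∀ j k, ContDiffOn ℝ ∞ (fun y => g y j k) U)
    (hdet : ∀ y ∈ U, (g y).det ≠ 0) {z : Cn n} (hz : z ∈ U)
    (hsymm : ∀ m j k, wirtinger s m (fun y => g y j k) z = wirtinger s j (fun y => g y m k) z)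
    (k : Fin n) :
    ∑ j, wirtinger s j (fun y => (g y).det * (g y)⁻¹ k j) z = 0 := by
  have hd {φ : Cn n → ℂ} (h : ContDiffOn ℝ ∞ φ U) : DifferentiableAt ℝ φ z :=
    (h.contDiffAt (hU.mem_nhds hz)).differentiableAt (by simp)
  have h1 (j : Fin n) : wirtinger s j (fun y => (g y).det * (g y)⁻¹ k j) z =
      (g z).det * (∑ q, ∑ p, (g z)⁻¹ q p * wirtinger s j (fun y => g y p q) z * (g z)⁻¹ k j -
        ∑ q, ∑ p, (g z)⁻¹ k p * wirtinger s j (fun y => g y p q) z * (g z)⁻¹ q j) := by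
    rw [wirtinger_mul (hd (contDiffOn_det hg)) (hd (contDiffOn_matrix_inv hg hdet k j)),
      wirtinger_det_eq_mul_trace (fun a b => hd (hg a b)) (hdet z hz)]
    have := congrFun (congrFun (wirtingerMatrix_inv (s := s) (m := j) hU hg hdet hz) k) j
    change wirtinger s j (fun y => (g y)⁻¹ k j) z = _ at this
    rw [this]
    simp only [Matrix.trace, Matrix.diag, Matrix.mul_apply, Matrix.neg_apply, Finset.sum_mul,
      wirtingerMatrix, Matrix.of_apply, Finset.mul_sum, mul_add, mul_neg, sub_eq_add_neg]
    congr 1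
    refine Finset.sum_congr rfl fun q _ => Finset.sum_congr rfl fun p _ => by ring
  simp only [h1]
  rw [← Finset.mul_sum, Finset.sum_sub_distrib]
  rw [sub_eq_zero.2, mul_zero]
  -- exchange `j` and `p` in the second sum
  rw [Finset.sum_comm]
  conv_rhs => rw [Finset.sum_comm]
  refine Finset.sum_congr rfl fun q _ => ?_
  conv_rhs => rw [Finset.sum_comm]
  refine Finset.sum_congr rfl fun j _ => Finset.sum_congr rfl fun p _ => ?_
  rw [hsymm j p q]; ring

/-- If `∂g_{jk}/∂z_m` is symmetric in `m` and `k` then the columns of `det g · g⁻¹` are divergence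
free. -/
theorem sum_wirtinger_det_mul_inv' {s : ℂ} {g : Cn n → Matrix (Fin n) (Fin n) ℂ}
    {U : Set (Cn n)} (hU : IsOpen U) (hg : ∀ j k, ContDiffOn ℝ ∞ (fun y => g y j k) U)
    (hdet : ∀ y ∈ U, (g y).det ≠ 0) {z : Cn n} (hz : z ∈ U)
    (hsymm : ∀ m j k, wirtinger s m (fun y => g y j k) z = wirtinger s k (fun y => g y j m) z)
    (j : Fin n) :
    ∑ k, wirtinger s k (fun y => (g y).det * (g y)⁻¹ k j) z = 0 := by
  have h := sum_wirtinger_det_mul_inv (g := fun y => (g y).transpose) (s := s) hU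
    (fun a b => hg b a) (fun y hy => by rw [Matrix.det_transpose]; exact hdet y hy) hz
    (fun m a b => hsymm m b a) j
  simpa only [Matrix.det_transpose, ← Matrix.transpose_nonsing_inv, Matrix.transpose_apply] using h

end MatrixCalculus

section ChainRule

variable {n : ℕ}

/-- The complex Jacobian matrix `∂Φ_l/∂z_k` of a holomorphic map. -/
def jacobian (Φ : Cn n → Cn n) (z : Cn n) : Matrix (Fin n) (Fin n) ℂ :=
  LinearMap.toMatrix' (fderiv ℂ Φ z : Cn n →ₗ[ℂ] Cn n)

theorem fderiv_apply_eq_jacobian (Φ : Cn n → Cn n) (z w : Cn n) :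
    fderiv ℂ Φ z w = (jacobian Φ z).mulVec w := by
  rw [jacobian, LinearMap.toMatrix'_mulVec]; rfl

theorem jacobian_apply (Φ : Cn n → Cn n) (z : Cn n) (l k : Fin n) :
    jacobian Φ z l k = fderiv ℂ Φ z (Pi.single k 1) l := by
  rw [fderiv_apply_eq_jacobian, Matrix.mulVec_single_one]; rfl

/-- A real linear form on `ℂⁿ` is determined by its `(1,0)` and `(0,1)` parts. -/
theorem fderiv_apply_eq_sum (φ : Cn n → ℂ) (z w : Cn n) :
    fderiv ℝ φ z w = ∑ l, (w l * dz l φ z + star (w l) * dzbar l φ z) := by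
  conv_lhs => rw [← Finset.univ_sum_single w, map_sum]
  refine Finset.sum_congr rfl fun j _ => ?_
  have hs : (Pi.single j (w j) : Cn n) =
      (w j).re • (Pi.single j 1 : Cn n) + (w j).im • (Pi.single j Complex.I : Cn n) := by
    rw [← Pi.single_smul, ← Pi.single_smul, ← Pi.single_add]
    congr 1
    apply Complex.ext <;> simp
  rw [hs, map_add, map_smul, map_smul, dz, dzbar]
  conv_rhs => rw [← Complex.re_add_im (w j)]
  simp only [Complex.real_smul, star_add, star_mul', Complex.star_def, Complex.conj_ofReal,
    Complex.conj_I]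
  linear_combination (((w j).im : ℂ) * fderiv ℝ φ z (Pi.single j Complex.I)) * Complex.I_mul_I

theorem fderiv_comp_holomorphic {φ : Cn n → ℂ} {Φ : Cn n → Cn n} {z : Cn n}
    (hΦ : DifferentiableAt ℂ Φ z) (hφ : DifferentiableAt ℝ φ (Φ z)) (w : Cn n) :
    fderiv ℝ (fun y => φ (Φ y)) z w = fderiv ℝ φ (Φ z) (fderiv ℂ Φ z w) := by
  have := hφ.hasFDerivAt.comp z (hΦ.hasFDerivAt.restrictScalars ℝ)
  have h2 : fderiv ℝ (fun y => φ (Φ y)) z = _ := this.fderiv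
  rw [h2]; rfl

theorem single_I_eq (k : Fin n) :
    (Pi.single k Complex.I : Cn n) = Complex.I • (Pi.single k 1 : Cn n) := by
  rw [← Pi.single_smul]; simp

theorem dzbar_comp {φ : Cn n → ℂ} {Φ : Cn n → Cn n} {z : Cn n}
    (hΦ : DifferentiableAt ℂ Φ z) (hφ : DifferentiableAt ℝ φ (Φ z)) (k : Fin n) :
    dzbar k (fun y => φ (Φ y)) z = ∑ l, star (jacobian Φ z l k) * dzbar l φ (Φ z) := by
  rw [dzbar, fderiv_comp_holomorphic hΦ hφ, fderiv_comp_holomorphic hΦ hφ, single_I_eq, map_smul,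
    fderiv_apply_eq_sum, fderiv_apply_eq_sum, Finset.mul_sum, ← Finset.sum_add_distrib,
    Finset.mul_sum]
  refine Finset.sum_congr rfl fun l _ => ?_
  simp only [jacobian_apply, Pi.smul_apply, smul_eq_mul, star_mul', Complex.star_def,
    Complex.conj_I]
  linear_combination (1 / 2 * (fderiv ℂ Φ z (Pi.single k 1) l * dz l φ (Φ z) -
    (starRingEnd ℂ) (fderiv ℂ Φ z (Pi.single k 1) l) * dzbar l φ (Φ z))) * Complex.I_mul_I

theorem dz_comp {φ : Cn n → ℂ} {Φ : Cn n → Cn n} {z : Cn n}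
    (hΦ : DifferentiableAt ℂ Φ z) (hφ : DifferentiableAt ℝ φ (Φ z)) (k : Fin n) :
    dz k (fun y => φ (Φ y)) z = ∑ l, jacobian Φ z l k * dz l φ (Φ z) := by
  rw [dz, fderiv_comp_holomorphic hΦ hφ, fderiv_comp_holomorphic hΦ hφ, single_I_eq, map_smul,
    fderiv_apply_eq_sum, fderiv_apply_eq_sum, Finset.mul_sum, ← Finset.sum_sub_distrib,
    Finset.mul_sum]
  refine Finset.sum_congr rfl fun l _ => ?_
  simp only [jacobian_apply, Pi.smul_apply, smul_eq_mul, star_mul', Complex.star_def,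
    Complex.conj_I]
  linear_combination (1 / 2 * (-fderiv ℂ Φ z (Pi.single k 1) l * dz l φ (Φ z) +
    (starRingEnd ℂ) (fderiv ℂ Φ z (Pi.single k 1) l) * dzbar l φ (Φ z))) * Complex.I_mul_I

/-- The complex Hessian is a tensor with respect to holomorphic changes of coordinates. -/
theorem ddbar_comp {φ : Cn n → ℂ} {Φ : Cn n → Cn n} {U U' : Set (Cn n)} (hU : IsOpen U)
    (hU' : IsOpen U') (hΦ : ContDiffOn ℂ ω Φ U) (hmaps : Set.MapsTo Φ U U')
    (hφ : ContDiffOn ℝ ∞ φ U') {z : Cn n} (hz : z ∈ U) :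
    ddbar (fun y => φ (Φ y)) z =
      (jacobian Φ z).transpose * ddbar φ (Φ z) * (jacobian Φ z).map star := by
  have hΦz : ∀ y ∈ U, DifferentiableAt ℂ Φ y := fun y hy =>
    (hΦ.contDiffAt (hU.mem_nhds hy)).differentiableAt (by simp)
  have hd {ψ : Cn n → ℂ} (h : ContDiffOn ℝ ∞ ψ U') {y : Cn n} (hy : y ∈ U) :
      DifferentiableAt ℝ ψ (Φ y) :=
    (h.contDiffAt (hU'.mem_nhds (hmaps hy))).differentiableAt (by simp)
  have hdb (l : Fin n) : ContDiffOn ℝ ∞ (dzbar l φ) U' := contDiffOn_wirtinger hU' hφ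
  -- the entries of the Jacobian are holomorphic
  have hJ (l k : Fin n) : DifferentiableAt ℂ (fun y => jacobian Φ y l k) z := by
    simp only [jacobian_apply]
    have h1 : DifferentiableAt ℂ (fun y => fderiv ℂ Φ y (Pi.single k 1)) z :=
      (((hΦ.contDiffAt (hU.mem_nhds hz)).fderiv_right (m := 1) (by simp)).differentiableAt
        (by simp)).clm_apply
        (differentiableAt_const _)
    exact differentiableAt_pi.1 h1 l
  have hJs (l k : Fin n) : DifferentiableAt ℝ (fun y => star (jacobian Φ y l k)) z :=
    Complex.conjCLE.differentiableAt.comp z ((hJ l k).restrictScalars ℝ)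
  have hcomp (l : Fin n) : DifferentiableAt ℝ (fun y => dzbar l φ (Φ y)) z :=
    DifferentiableAt.comp (g := dzbar l φ) z (hd (hdb l) hz) ((hΦz z hz).restrictScalars ℝ)
  ext j k
  rw [ddbar, Matrix.of_apply, dz_eq_wirtinger, wirtinger_congr_of_eqOn hU
    (fun y hy => dzbar_comp (hΦz y hy) (hd hφ hy) k) hz,
    wirtinger_sum fun l _ => (hJs l k).fun_mul (hcomp l), Matrix.mul_apply]
  refine Finset.sum_congr rfl fun l _ => ?_
  rw [wirtinger_mul (hJs l k) (hcomp l), ← dz_eq_wirtinger, ← dz_eq_wirtinger,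
    dz_eq_zero_of_conj (hJ l k), zero_mul,
    zero_add, dz_comp (hΦz z hz) (hd (hdb l) hz), Matrix.mul_apply, Matrix.map_apply, mul_comm]
  rfl

end ChainRule

section IntegrationByParts

variable {n : ℕ}

theorem integral_fderiv_apply_eq_zero {φ : Cn n → ℂ} (hφ : ContDiff ℝ 1 φ)
    (hc : HasCompactSupport φ) (w : Cn n) : ∫ z, fderiv ℝ φ z w = 0 := by
  have h1 : Integrable (fun z => fderiv ℝ φ z w) :=
    ((hφ.continuous_fderiv (by simp)).clm_apply continuous_const).integrable_of_hasCompactSupport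
      (hc.fderiv_apply (𝕜 := ℝ) w)
  have := integral_mul_fderiv_eq_neg_fderiv_mul_of_integrable (μ := (volume : Measure (Cn n)))
    (f := fun _ : Cn n => (1 : ℂ)) (g := φ) (v := w) (by simp) (by simpa using h1)
    (by simpa using hφ.continuous.integrable_of_hasCompactSupport hc)
    (fun _ _ => differentiableAt_const _) (fun x _ => hφ.differentiable (by simp) x)
  simpa using this

/-- The divergence theorem for functions with compact support in an open set. -/
theorem setIntegral_wirtinger_eq_zero {s : ℂ} {j : Fin n} {φ : Cn n → ℂ} {U T : Set (Cn n)}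
    (hU : IsOpen U) (hT : IsCompact T) (hTU : T ⊆ U) (hφ : ContDiffOn ℝ ∞ φ U)
    (h0 : ∀ z ∈ U, z ∉ T → φ z = 0) : ∫ z in U, wirtinger s j φ z = 0 := by
  set ψ : Cn n → ℂ := U.indicator φ with hψ
  have hψ0 : ∀ z ∉ T, ψ z = 0 := fun z hz => by
    by_cases hzU : z ∈ U
    · rw [hψ, Set.indicator_of_mem hzU, h0 z hzU hz]
    · rw [hψ, Set.indicator_of_notMem hzU]
  have hsm : ContDiff ℝ 1 ψ := by
    rw [contDiff_iff_contDiffAt]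
    intro z
    by_cases hz : z ∈ T
    · have : ψ =ᶠ[nhds z] φ :=
        (Set.eqOn_indicator).eventuallyEq_of_mem (hU.mem_nhds (hTU hz))
      exact (((hφ.contDiffAt (hU.mem_nhds (hTU hz))).of_le (by simp)).congr_of_eventuallyEq this)
    · have : ψ =ᶠ[nhds z] fun _ => 0 :=
        Filter.eventuallyEq_of_mem (hT.isClosed.isOpen_compl.mem_nhds hz) fun y hy => hψ0 y hy
      exact contDiffAt_const.congr_of_eventuallyEq this
  have hcs : HasCompactSupport ψ := HasCompactSupport.intro hT fun z hz => hψ0 z hz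
  have h1 : ∫ z in U, wirtinger s j φ z = ∫ z, wirtinger s j ψ z := by
    rw [← setIntegral_eq_integral_of_forall_compl_eq_zero (s := U) (f := wirtinger s j ψ)]
    · refine setIntegral_congr_fun hU.measurableSet fun z hz => ?_
      exact wirtinger_congr_of_eqOn hU Set.eqOn_indicator.symm hz
    · intro z hz
      rw [wirtinger_congr (ψ := fun _ => 0), wirtinger_const]
      exact Filter.eventuallyEq_of_mem (hT.isClosed.isOpen_compl.mem_nhds fun h => hz (hTU h))
        fun y hy => hψ0 y hy
  have hi (w : Cn n) : Integrable (fun z => fderiv ℝ ψ z w) :=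
    ((hsm.continuous_fderiv (by simp)).clm_apply continuous_const).integrable_of_hasCompactSupport
      (hcs.fderiv_apply (𝕜 := ℝ) w)
  rw [h1]
  simp only [wirtinger]
  rw [integral_const_mul, integral_add (hi _) ((hi _).const_mul s), integral_const_mul,
    integral_fderiv_apply_eq_zero hsm hcs, integral_fderiv_apply_eq_zero hsm hcs]
  simp

end IntegrationByParts

/-! ### Charts and tangent vectors -/

section Charts

variable {n : ℕ} {X : Type*} [TopologicalSpace X] [ChartedSpace (Cn n) X]

/-- The change of coordinates between two charts is holomorphic. -/
theorem contDiffOn_transition [IsManifold 𝓘(ℂ, Cn n) ω X] {e e' : OpenPartialHomeomorph X (Cn n)}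
    (he : e ∈ atlas (Cn n) X) (he' : e' ∈ atlas (Cn n) X) :
    ContDiffOn ℂ ω (fun y => e' (e.symm y)) (e.symm ≫ₕ e').source := by
  have h := (contDiffGroupoid ω 𝓘(ℂ, Cn n)).compatible he he' |>.1
  have h2 : ContDiffOn ℂ ω (𝓘(ℂ, Cn n) ∘ (e.symm ≫ₕ e') ∘ 𝓘(ℂ, Cn n).symm)
      (𝓘(ℂ, Cn n).symm ⁻¹' (e.symm ≫ₕ e').source ∩ Set.range 𝓘(ℂ, Cn n)) := h
  simpa using! h2

/-- On a complex manifold the real derivative of an inverse chart, read in the preferred chart, is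
the complex derivative. -/
theorem chartPush_apply [IsManifold 𝓘(ℂ, Cn n) ω X] {e : OpenPartialHomeomorph X (Cn n)}
    (he : e ∈ atlas (Cn n) X) {z : Cn n} (hz : z ∈ e.target) (w : Cn n) :
    (show Cn n from chartPush e z w) =
      fderiv ℂ (fun y => chartAt (Cn n) (e.symm z) (e.symm y)) z w := by
  have := isManifold_real n X
  have hd : DifferentiableAt ℂ (fun y => chartAt (Cn n) (e.symm z) (e.symm y)) z :=
    ((contDiffOn_transition he (chart_mem_atlas _ _)).contDiffAt
      ((e.symm ≫ₕ chartAt (Cn n) (e.symm z)).open_source.mem_nhds (by simp [hz]))).differentiableAt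
      (by simp)
  have hm : MDifferentiableAt 𝓘(ℝ, Cn n) 𝓘(ℝ, Cn n) e.symm z :=
    mdifferentiableAt_atlas_symm he hz
  have : chartPush e z = fderiv ℝ (fun y => chartAt (Cn n) (e.symm z) (e.symm y)) z := by
    refine hm.mfderiv.trans ?_
    have h : fderivWithin ℝ (writtenInExtChartAt 𝓘(ℝ, Cn n) 𝓘(ℝ, Cn n) z e.symm)
        (Set.range 𝓘(ℝ, Cn n)) (extChartAt 𝓘(ℝ, Cn n) z z) =
        fderiv ℝ (fun y => chartAt (Cn n) (e.symm z) (e.symm y)) z := by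
      simp only [mfld_simps, fderivWithin_univ]
      rfl
    exact h
  rw [this, hd.fderiv_restrictScalars ℝ]
  rfl

theorem chartPush_smul [IsManifold 𝓘(ℂ, Cn n) ω X] {e : OpenPartialHomeomorph X (Cn n)}
    (he : e ∈ atlas (Cn n) X) {z : Cn n} (hz : z ∈ e.target) (c : ℂ) (w : Cn n) :
    chartPush e z (c • w) = toRT (c • toCT (chartPush e z w)) := by
  have h1 := chartPush_apply he hz (c • w)
  have h2 := chartPush_apply he hz w
  refine h1.trans ?_
  rw [map_smul]
  exact congrArg (fun u : Cn n => c • u) h2.symm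

theorem J_chartPush [IsManifold 𝓘(ℂ, Cn n) ω X] {e : OpenPartialHomeomorph X (Cn n)}
    (he : e ∈ atlas (Cn n) X) {z : Cn n} (hz : z ∈ e.target) (w : Cn n) :
    J (chartPush e z w) = chartPush e z (Complex.I • w) :=
  (chartPush_smul he hz _ w).symm

theorem chartPush_injective [IsManifold 𝓘(ℂ, Cn n) ω X] {e : OpenPartialHomeomorph X (Cn n)}
    (he : e ∈ atlas (Cn n) X) {z : Cn n} (hz : z ∈ e.target) :
    Function.Injective (chartPush e z) := by
  have := isManifold_real n X
  exact (mdifferentiable_of_mem_atlas (I := 𝓘(ℝ, Cn n)) he).symm.mfderiv_injective hz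

/-- The derivatives of two inverse charts differ by the derivative of the change of coordinates.
Base point and derivative are compared together, since the base points agree only
propositionally. -/
theorem chartPush_change [IsManifold 𝓘(ℂ, Cn n) ω X] {e e' : OpenPartialHomeomorph X (Cn n)}
    (he : e ∈ atlas (Cn n) X) (he' : e' ∈ atlas (Cn n) X) {z : Cn n}
    (hz : z ∈ (e.symm ≫ₕ e').source) :
    (⟨e.symm z, fun w => chartPush e z w⟩ : Σ x : X, Cn n → RT n x) =
      ⟨e'.symm (e' (e.symm z)), fun w => chartPush e' (e' (e.symm z))
        (fderiv ℂ (fun y => e' (e.symm y)) z w)⟩ := by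
  have := isManifold_real n X
  have hz' : z ∈ e.target ∧ e.symm z ∈ e'.source := by simpa using hz
  have hx : e'.symm (e' (e.symm z)) = e.symm z := e'.left_inv hz'.2
  have hd : DifferentiableAt ℂ (fun y => e' (e.symm y)) z :=
    ((contDiffOn_transition he he').contDiffAt
      ((e.symm ≫ₕ e').open_source.mem_nhds hz)).differentiableAt (by simp)
  have hm' : MDifferentiableAt 𝓘(ℝ, Cn n) 𝓘(ℝ, Cn n) e'.symm (e' (e.symm z)) :=
    mdifferentiableAt_atlas_symm he' (e'.map_source hz'.2)
  have hcomp := hm'.hasMFDerivAt.comp z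
    (hd.restrictScalars ℝ).hasFDerivAt.hasMFDerivAt
  have hev : (e'.symm ∘ fun y => e' (e.symm y)) =ᶠ[nhds z] e.symm := by
    filter_upwards [(e.symm ≫ₕ e').open_source.mem_nhds hz] with y hy
    have hy' : y ∈ e.target ∧ e.symm y ∈ e'.source := by simpa using hy
    exact e'.left_inv hy'.2
  have h2 := (hcomp.congr_of_eventuallyEq hev.symm).mfderiv
  rw [hd.fderiv_restrictScalars ℝ] at h2
  refine Sigma.ext hx.symm (heq_of_eq ?_)
  funext w
  exact DFunLike.congr_fun h2 w

theorem diff_chartPush [IsManifold 𝓘(ℂ, Cn n) ω X] {e : OpenPartialHomeomorph X (Cn n)}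
    (he : e ∈ atlas (Cn n) X) {z : Cn n} (hz : z ∈ e.target) {F : X → ℂ}
    (hF : ContMDiff 𝓘(ℝ, Cn n) 𝓘(ℝ, ℂ) ∞ F) (w : Cn n) :
    diff F (e.symm z) (chartPush e z w) = fderiv ℝ (fun y => F (e.symm y)) z w := by
  have := isManifold_real n X
  have hm : MDifferentiableAt 𝓘(ℝ, Cn n) 𝓘(ℝ, Cn n) e.symm z :=
    mdifferentiableAt_atlas_symm he hz
  have h := mfderiv_comp_apply z ((hF (e.symm z)).mdifferentiableAt (by simp)) hm w
  refine h.symm.trans ?_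
  rw [mfderiv_eq_fderiv]
  rfl

/-- Smooth functions are smooth in charts. -/
theorem contDiffOn_comp_symm [IsManifold 𝓘(ℂ, Cn n) ω X] {e : OpenPartialHomeomorph X (Cn n)}
    (he : e ∈ atlas (Cn n) X) {F : X → ℂ} (hF : ContMDiff 𝓘(ℝ, Cn n) 𝓘(ℝ, ℂ) ∞ F) :
    ContDiffOn ℝ ∞ (fun y => F (e.symm y)) e.target := by
  have := isManifold_real n X
  exact (hF.comp_contMDiffOn (contMDiffOn_symm_of_mem_maximalAtlas
    (IsManifold.subset_maximalAtlas he))).contDiffOn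

/-- The coordinate components of a `(1,0)`-vector field in a chart. -/
def components (v : ∀ x : X, CT n x) (e : OpenPartialHomeomorph X (Cn n)) (z : Cn n) : Cn n :=
  mfderiv 𝓘(ℂ, Cn n) 𝓘(ℂ, Cn n) e (e.symm z) (v (e.symm z))

/-- The components recover the vector field. -/
theorem chartPush_components [IsManifold 𝓘(ℂ, Cn n) ω X] (v : ∀ x : X, CT n x)
    {e : OpenPartialHomeomorph X (Cn n)} (he : e ∈ atlas (Cn n) X) {z : Cn n}
    (hz : z ∈ e.target) : chartPush e z (components v e z) = toRT (v (e.symm z)) := by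
  have h := chartPush_apply he hz (components v e z)
  have : IsManifold 𝓘(ℂ, Cn n) 1 X := IsManifold.of_le (n := ω) le_top
  have hm := mdifferentiable_of_mem_atlas (I := 𝓘(ℂ, Cn n)) he
  have h1 := hm.symm_comp_deriv (e.map_target hz)
  rw [e.right_inv hz] at h1
  have h2 := DFunLike.congr_fun h1 (v (e.symm z))
  refine Eq.trans ?_ h2
  refine h.trans ?_
  have hms : MDifferentiableAt 𝓘(ℂ, Cn n) 𝓘(ℂ, Cn n) e.symm z := hm.mdifferentiableAt_symm hz
  have h3 : mfderiv 𝓘(ℂ, Cn n) 𝓘(ℂ, Cn n) e.symm z =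
      fderiv ℂ (fun y => chartAt (Cn n) (e.symm z) (e.symm y)) z := by
    refine hms.mfderiv.trans ?_
    have h : fderivWithin ℂ (writtenInExtChartAt 𝓘(ℂ, Cn n) 𝓘(ℂ, Cn n) z e.symm)
        (Set.range 𝓘(ℂ, Cn n)) (extChartAt 𝓘(ℂ, Cn n) z z) =
        fderiv ℂ (fun y => chartAt (Cn n) (e.symm z) (e.symm y)) z := by
      simp only [mfld_simps, fderivWithin_univ]
      rfl
    exact h
  change _ = mfderiv 𝓘(ℂ, Cn n) 𝓘(ℂ, Cn n) e.symm z (components v e z)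
  exact (congrArg (fun L : Cn n →L[ℂ] Cn n => L (components v e z)) h3).symm

/-- The components of a holomorphic vector field in a preferred chart are holomorphic functions. -/
theorem contDiffOn_components_holomorphic [IsManifold 𝓘(ℂ, Cn n) ω X] {v : ∀ x : X, CT n x}
    (hv : IsHolomorphicField v) (i : X) :
    ContDiffOn ℂ ω (components v (chartAt (Cn n) i)) (chartAt (Cn n) i).target := by
  have : IsManifold 𝓘(ℂ, Cn n) 1 X := IsManifold.of_le (n := ω) le_top
  have hs := ((trivializationAt (Cn n) (TangentSpace 𝓘(ℂ, Cn n) (M := X)) i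
    ).contMDiffOn_section_baseSet_iff (IB := 𝓘(ℂ, Cn n)) (n := ω)).1 hv.contMDiffOn
  have he := chart_mem_atlas (Cn n) i
  have h2 := (hs.comp (contMDiffOn_symm_of_mem_maximalAtlas
    (IsManifold.subset_maximalAtlas he)) (fun z hz => (chartAt (Cn n) i).map_target hz)).contDiffOn
  refine h2.congr fun z hz => ?_
  have hz' := (chartAt (Cn n) i).map_target hz
  have h3 := TangentBundle.continuousLinearMapAt_trivializationAt (I := 𝓘(ℂ, Cn n)) hz'
  have h4 := DFunLike.congr_fun h3 (v ((chartAt (Cn n) i).symm z))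
  have h5 : (extChartAt 𝓘(ℂ, Cn n) i : X → Cn n) = chartAt (Cn n) i := by simp [mfld_simps]
  rw [Bundle.Trivialization.continuousLinearMapAt_apply_of_mem _ _ hz'] at h4
  rw [h5] at h4
  exact h4.symm

end Charts

/-! ### The Kähler metric in a chart -/

section Metric

variable {n : ℕ} {X : Type*} [TopologicalSpace X] [ChartedSpace (Cn n) X]

theorem localForm_apply (α : ∀ x : X, RT n x [⋀^Fin 2]→L[ℝ] ℝ)
    (e : OpenPartialHomeomorph X (Cn n)) (z a b : Cn n) :
    localForm α e z ![a, b] = α (e.symm z) ![chartPush e z a, chartPush e z b] := by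
  rw [localForm, ContinuousAlternatingMap.compContinuousLinearMap_apply]
  congr 1
  funext i
  fin_cases i <;> rfl

theorem altTwo_swap {V : Type*} [NormedAddCommGroup V] [NormedSpace ℝ V] (β : V [⋀^Fin 2]→L[ℝ] ℝ)
    (a b : V) : β ![a, b] = -β ![b, a] := by
  have h := β.map_swap ![b, a] (i := 0) (j := 1) (by simp)
  have h2 : (![b, a] ∘ Equiv.swap (0 : Fin 2) 1 : Fin 2 → V) = ![a, b] := by
    funext i
    fin_cases i <;> simp
  rw [h2] at h
  exact h

theorem altTwo_add_left {V : Type*} [NormedAddCommGroup V] [NormedSpace ℝ V]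
    (β : V [⋀^Fin 2]→L[ℝ] ℝ) (a b c : V) : β ![a + b, c] = β ![a, c] + β ![b, c] :=
  β.vecCons_add _ _ _

theorem altTwo_smul_left {V : Type*} [NormedAddCommGroup V] [NormedSpace ℝ V]
    (β : V [⋀^Fin 2]→L[ℝ] ℝ) (r : ℝ) (a c : V) : β ![r • a, c] = r * β ![a, c] :=
  β.vecCons_smul _ _ _

theorem altTwo_smul_right {V : Type*} [NormedAddCommGroup V] [NormedSpace ℝ V]
    (β : V [⋀^Fin 2]→L[ℝ] ℝ) (r : ℝ) (a c : V) : β ![a, r • c] = r * β ![a, c] := by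
  rw [altTwo_swap, altTwo_smul_left, altTwo_swap β c]; ring

theorem complex_smul_eq (c : ℂ) (w : Cn n) : c • w = c.re • w + c.im • (Complex.I • w) := by
  ext j
  simp only [Pi.smul_apply, Pi.add_apply, smul_eq_mul, Complex.real_smul]
  rw [← mul_assoc, ← add_mul, Complex.re_add_im]

open scoped ComplexOrder

namespace KahlerForm

variable (K : KahlerForm n X) {e : OpenPartialHomeomorph X (Cn n)}

/-- The value on `a` and `b` of the Hermitian form `½ (ω(a, √-1 b) - √-1 ω(a, b))` of the Kähler
metric in a chart.  It is linear in `a` and antilinear in `b`. -/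
def hermAux (e : OpenPartialHomeomorph X (Cn n)) (z a b : Cn n) : ℂ :=
  (1 / 2) * ((localForm K.form e z ![a, Complex.I • b] : ℂ) -
    Complex.I * (localForm K.form e z ![a, b] : ℂ))

theorem hermAux_add_left (z a b c : Cn n) :
    K.hermAux e z (a + b) c = K.hermAux e z a c + K.hermAux e z b c := by
  simp only [hermAux, altTwo_add_left]; push_cast; ring

theorem differentiableAt_localForm (he : e ∈ atlas (Cn n) X) {z : Cn n} (hz : z ∈ e.target) :
    DifferentiableAt ℝ (localForm K.form e) z :=
  ((K.smooth e he).contDiffAt (e.open_target.mem_nhds hz)).differentiableAt (by simp)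

theorem contDiffOn_localForm_apply (he : e ∈ atlas (Cn n) X) (a b : Cn n) :
    ContDiffOn ℝ ∞ (fun z => localForm K.form e z ![a, b]) e.target :=
  (ContinuousAlternatingMap.apply ℝ (Cn n) ℝ ![a, b]).contDiff.comp_contDiffOn (K.smooth e he)

/-- The equation `dω = 0` in a chart, on three constant vector fields. -/
theorem closed_apply (he : e ∈ atlas (Cn n) X) {z : Cn n} (hz : z ∈ e.target) (a b c : Cn n) :
    fderiv ℝ (fun y => localForm K.form e y ![b, c]) z a -
      fderiv ℝ (fun y => localForm K.form e y ![a, c]) z b +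
      fderiv ℝ (fun y => localForm K.form e y ![a, b]) z c = 0 := by
  have h := congrArg (fun β => β ![a, b, c]) (K.closed e he z hz)
  replace h := (Fin.sum_univ_three _).symm.trans
    ((extDeriv_apply (K.differentiableAt_localForm he hz) ![a, b, c]).symm.trans h)
  have h0 : Fin.removeNth 0 ![a, b, c] = ![b, c] := by
    funext i; fin_cases i <;> rfl
  have h1 : Fin.removeNth 1 ![a, b, c] = ![a, c] := by
    funext i; fin_cases i <;> rfl
  have h2 : Fin.removeNth 2 ![a, b, c] = ![a, b] := by
    funext i; fin_cases i <;> rfl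
  rw [h0, h1, h2] at h
  simpa [sub_eq_add_neg] using h

theorem fderiv_localForm_swap (e : OpenPartialHomeomorph X (Cn n)) (z a b w : Cn n) :
    fderiv ℝ (fun y => localForm K.form e y ![a, b]) z w =
      -fderiv ℝ (fun y => localForm K.form e y ![b, a]) z w := by
  have : (fun y => localForm K.form e y ![a, b]) = fun y => -localForm K.form e y ![b, a] :=
    funext fun y => altTwo_swap _ a b
  rw [this, fderiv_fun_neg]; rfl

variable [IsManifold 𝓘(ℂ, Cn n) ω X]

theorem localForm_I_I (he : e ∈ atlas (Cn n) X) {z : Cn n} (hz : z ∈ e.target) (a b : Cn n) :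
    localForm K.form e z ![Complex.I • a, Complex.I • b] = localForm K.form e z ![a, b] := by
  rw [localForm_apply, localForm_apply, ← J_chartPush he hz, ← J_chartPush he hz]
  exact K.type_one_one _ _ _

theorem localForm_I_left (he : e ∈ atlas (Cn n) X) {z : Cn n} (hz : z ∈ e.target) (a b : Cn n) :
    localForm K.form e z ![Complex.I • a, b] = -localForm K.form e z ![a, Complex.I • b] := by
  rw [← K.localForm_I_I he hz, smul_smul, Complex.I_mul_I]
  have : ((-1 : ℂ) • a) = (-1 : ℝ) • a := by simp
  rw [this, altTwo_smul_left]; ring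

theorem hermAux_conj (he : e ∈ atlas (Cn n) X) {z : Cn n} (hz : z ∈ e.target) (a b : Cn n) :
    star (K.hermAux e z a b) = K.hermAux e z b a := by
  rw [hermAux, hermAux, altTwo_swap _ b, altTwo_swap _ b, K.localForm_I_left he hz]
  simp

theorem hermAux_smul_left (he : e ∈ atlas (Cn n) X) {z : Cn n} (hz : z ∈ e.target) (c : ℂ)
    (a b : Cn n) : K.hermAux e z (c • a) b = c * K.hermAux e z a b := by
  have hm : localForm K.form e z ![a, Complex.I • Complex.I • b] =
      -localForm K.form e z ![a, b] := by
    have : (Complex.I • Complex.I • b) = (-1 : ℝ) • b := by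
      rw [smul_smul, Complex.I_mul_I]; simp
    rw [this, altTwo_smul_right]; ring
  rw [complex_smul_eq c a]
  conv_rhs => rw [← Complex.re_add_im c]
  simp only [hermAux, altTwo_add_left, altTwo_smul_left, K.localForm_I_left he hz, hm]
  push_cast
  linear_combination (1 / 2 * (c.im : ℂ) * (localForm K.form e z ![a, b] : ℂ)) * Complex.I_mul_I

/-- The Hermitian form of the Kähler metric in a chart. -/
def herm (he : e ∈ atlas (Cn n) X) {z : Cn n} (hz : z ∈ e.target) :
    Cn n →ₗ[ℂ] Cn n →ₗ⋆[ℂ] ℂ :=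
  LinearMap.mk₂'ₛₗ (RingHom.id ℂ) (starRingEnd ℂ) (K.hermAux e z)
    (K.hermAux_add_left z) (K.hermAux_smul_left he hz)
    (fun a b c => by
      rw [← K.hermAux_conj he hz, hermAux_add_left, star_add, K.hermAux_conj he hz,
        K.hermAux_conj he hz])
    (fun c a b => by
      rw [← K.hermAux_conj he hz, K.hermAux_smul_left he hz, star_mul', K.hermAux_conj he hz]
      rfl)

theorem metric_apply (he : e ∈ atlas (Cn n) X) {z : Cn n} (hz : z ∈ e.target) (j k : Fin n) :
    K.metric e z j k = K.hermAux e z (Pi.single j 1) (Pi.single k 1) := by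
  rw [metric, hermMatrix, Matrix.of_apply, hermAux, localForm_apply, localForm_apply, frame, frame,
    J_chartPush he hz]

theorem hermAux_eq_sum (he : e ∈ atlas (Cn n) X) {z : Cn n} (hz : z ∈ e.target) (a b : Cn n) :
    K.hermAux e z a b = ∑ l, ∑ m, a l * star (b m) * K.metric e z l m := by
  have hs (w : Cn n) : w = ∑ l, w l • (Pi.single l 1 : Cn n) := by
    conv_lhs => rw [← Finset.univ_sum_single w]
    refine Finset.sum_congr rfl fun l _ => ?_
    rw [← Pi.single_smul]; simp
  change K.herm he hz a b = _
  conv_lhs => rw [hs a, hs b]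
  simp only [map_sum, LinearMap.sum_apply, map_smul, LinearMap.smul_apply, LinearMap.map_smulₛₗ,
    smul_eq_mul]
  simp only [Finset.mul_sum]
  rw [Finset.sum_comm]
  refine Finset.sum_congr rfl fun l _ => Finset.sum_congr rfl fun m _ => ?_
  rw [K.metric_apply he hz, mul_left_comm, ← mul_assoc]
  rfl

theorem metric_posDef (he : e ∈ atlas (Cn n) X) {z : Cn n} (hz : z ∈ e.target) :
    (K.metric e z).PosDef := by
  refine Matrix.PosDef.of_dotProduct_mulVec_pos ?_ fun x hx => ?_
  · ext j k
    rw [Matrix.conjTranspose_apply, K.metric_apply he hz, K.metric_apply he hz,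
      K.hermAux_conj he hz]
  · have h1 : star x ⬝ᵥ (K.metric e z).mulVec x = K.hermAux e z (star x) (star x) := by
      rw [K.hermAux_eq_sum he hz]
      simp only [dotProduct, Matrix.mulVec, Finset.mul_sum, Pi.star_apply, star_star]
      exact Finset.sum_congr rfl fun l _ => Finset.sum_congr rfl fun m _ => by ring
    have h0 (a : Cn n) : localForm K.form e z ![a, a] = 0 := by
      have := altTwo_swap (localForm K.form e z) a a
      linarith
    have hx' : star x ≠ 0 := by simpa using hx
    have h2 : chartPush e z (star x) ≠ 0 := fun h => hx' (chartPush_injective he hz (by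
      rw [h, map_zero]))
    have h3 := K.pos (e.symm z) _ h2
    rw [J_chartPush he hz, ← localForm_apply] at h3
    rw [h1, hermAux, h0]
    have : (1 / 2 : ℂ) * ((localForm K.form e z ![star x, Complex.I • star x] : ℂ) -
        Complex.I * ((0 : ℝ) : ℂ)) =
        ((1 / 2 * localForm K.form e z ![star x, Complex.I • star x] : ℝ) : ℂ) := by
      push_cast; ring
    rw [this]
    exact Complex.zero_lt_real.2 (by positivity)

theorem metric_det_pos (he : e ∈ atlas (Cn n) X) {z : Cn n} (hz : z ∈ e.target) :
    0 < (K.metric e z).det := (K.metric_posDef he hz).det_pos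

theorem metric_det_ne_zero (he : e ∈ atlas (Cn n) X) {z : Cn n} (hz : z ∈ e.target) :
    (K.metric e z).det ≠ 0 := (K.metric_det_pos he hz).ne'

theorem metric_det_re_pos (he : e ∈ atlas (Cn n) X) {z : Cn n} (hz : z ∈ e.target) :
    0 < (K.metric e z).det.re := (Complex.pos_iff.1 (K.metric_det_pos he hz)).1

theorem ofReal_metric_det_re (he : e ∈ atlas (Cn n) X) {z : Cn n} (hz : z ∈ e.target) :
    ((K.metric e z).det.re : ℂ) = (K.metric e z).det :=
  Complex.ext rfl (Complex.pos_iff.1 (K.metric_det_pos he hz)).2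

/-- The transformation rule of the metric under a change of chart. -/
theorem metric_change {e' : OpenPartialHomeomorph X (Cn n)} (he : e ∈ atlas (Cn n) X)
    (he' : e' ∈ atlas (Cn n) X) {z : Cn n} (hz : z ∈ (e.symm ≫ₕ e').source) :
    K.metric e z = (jacobian (fun y => e' (e.symm y)) z).transpose *
      K.metric e' (e' (e.symm z)) * (jacobian (fun y => e' (e.symm y)) z).map star := by
  have hz' : z ∈ e.target ∧ e.symm z ∈ e'.source := by simpa using hz
  set A := fderiv ℂ (fun y => e' (e.symm y)) z with hA
  have h (a b : Cn n) : localForm K.form e z ![a, b] =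
      localForm K.form e' (e' (e.symm z)) ![A a, A b] := by
    rw [localForm_apply, localForm_apply]
    exact congrArg (fun p : Σ x : X, Cn n → RT n x => K.form p.1 ![p.2 a, p.2 b])
      (chartPush_change he he' hz)
  ext j k
  rw [K.metric_apply he hz'.1]
  have h2 : K.hermAux e z (Pi.single j 1) (Pi.single k 1) =
      K.hermAux e' (e' (e.symm z)) (A (Pi.single j 1)) (A (Pi.single k 1)) := by
    rw [hermAux, hermAux, h, h, map_smul]
  rw [h2, K.hermAux_eq_sum he' (e'.map_source hz'.2)]
  simp only [hA, ← jacobian_apply, Matrix.mul_apply, Matrix.transpose_apply, Matrix.map_apply,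
    Finset.sum_mul]
  rw [Finset.sum_comm]
  exact Finset.sum_congr rfl fun l _ => Finset.sum_congr rfl fun m _ => by ring

/-- The determinant of the metric changes by `|det ∂Φ|²` under a change of chart `Φ`. -/
theorem metric_det_change {e' : OpenPartialHomeomorph X (Cn n)} (he : e ∈ atlas (Cn n) X)
    (he' : e' ∈ atlas (Cn n) X) {z : Cn n} (hz : z ∈ (e.symm ≫ₕ e').source) :
    (K.metric e z).det = (Complex.normSq (jacobian (fun y => e' (e.symm y)) z).det : ℂ) *
      (K.metric e' (e' (e.symm z))).det := by
  rw [K.metric_change he he' hz, Matrix.det_mul, Matrix.det_mul, Matrix.det_transpose]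
  have : ((jacobian (fun y => e' (e.symm y)) z).map star).det =
      star (jacobian (fun y => e' (e.symm y)) z).det := by
    rw [← Matrix.det_conjTranspose, Matrix.conjTranspose, ← Matrix.det_transpose]
    rfl
  rw [this, ← Complex.mul_conj]
  simp only [Complex.star_def]
  ring

theorem contDiffOn_metric (he : e ∈ atlas (Cn n) X) (j k : Fin n) :
    ContDiffOn ℝ ∞ (fun z => K.metric e z j k) e.target := by
  refine ContDiffOn.congr ?_ fun z hz => K.metric_apply he hz j k
  have h (a b : Cn n) : ContDiffOn ℝ ∞ (fun z => (localForm K.form e z ![a, b] : ℂ)) e.target :=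
    Complex.ofRealCLM.contDiff.comp_contDiffOn (K.contDiffOn_localForm_apply he a b)
  exact contDiffOn_const.mul ((h _ _).sub (contDiffOn_const.mul (h _ _)))

theorem fderiv_metric (he : e ∈ atlas (Cn n) X) {z : Cn n} (hz : z ∈ e.target) (j k : Fin n)
    (w : Cn n) : fderiv ℝ (fun y => K.metric e y j k) z w =
      (1 / 2) * ((fderiv ℝ (fun y => localForm K.form e y
          ![Pi.single j 1, Complex.I • Pi.single k 1]) z w : ℂ) -
        Complex.I * (fderiv ℝ (fun y => localForm K.form e y
          ![Pi.single j 1, Pi.single k 1]) z w : ℂ)) := by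
  have hd (a b : Cn n) : HasFDerivAt (fun y => (localForm K.form e y ![a, b] : ℂ))
      (Complex.ofRealCLM.comp (fderiv ℝ (fun y => localForm K.form e y ![a, b]) z)) z :=
    Complex.ofRealCLM.hasFDerivAt.comp z
      (((K.contDiffOn_localForm_apply he a b).contDiffAt
        (e.open_target.mem_nhds hz)).differentiableAt (by simp)).hasFDerivAt
  have h : HasFDerivAt (fun y => K.metric e y j k) _ z :=
    (((hd (Pi.single j 1) (Complex.I • Pi.single k 1)).sub
      ((hd (Pi.single j 1) (Pi.single k 1)).const_mul Complex.I)).const_mul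
        (1 / 2 : ℂ)).congr_of_eventuallyEq (Filter.eventuallyEq_of_mem
        (e.open_target.mem_nhds hz) fun y hy => K.metric_apply he hy j k)
  rw [h.fderiv]
  rfl

theorem fderiv_localForm_I_left (he : e ∈ atlas (Cn n) X) {z : Cn n} (hz : z ∈ e.target)
    (a b w : Cn n) : fderiv ℝ (fun y => localForm K.form e y ![Complex.I • a, b]) z w =
      -fderiv ℝ (fun y => localForm K.form e y ![a, Complex.I • b]) z w := by
  have : (fun y => localForm K.form e y ![Complex.I • a, b]) =ᶠ[nhds z]
      fun y => -localForm K.form e y ![a, Complex.I • b] :=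
    Filter.eventuallyEq_of_mem (e.open_target.mem_nhds hz) fun y hy =>
      K.localForm_I_left he hy a b
  rw [this.fderiv_eq, fderiv_fun_neg]; rfl

theorem fderiv_localForm_I_I (he : e ∈ atlas (Cn n) X) {z : Cn n} (hz : z ∈ e.target)
    (a b w : Cn n) :
    fderiv ℝ (fun y => localForm K.form e y ![Complex.I • a, Complex.I • b]) z w =
      fderiv ℝ (fun y => localForm K.form e y ![a, b]) z w := by
  have : (fun y => localForm K.form e y ![Complex.I • a, Complex.I • b]) =ᶠ[nhds z]
      fun y => localForm K.form e y ![a, b] :=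
    Filter.eventuallyEq_of_mem (e.open_target.mem_nhds hz) fun y hy =>
      K.localForm_I_I he hy a b
  rw [this.fderiv_eq]

/-- The Kähler identity `∂g_{jk̄}/∂z_m = ∂g_{mk̄}/∂z_j`. -/
theorem dz_metric_symm (he : e ∈ atlas (Cn n) X) {z : Cn n} (hz : z ∈ e.target)
    (m j k : Fin n) : wirtinger (-Complex.I) m (fun y => K.metric e y j k) z =
      wirtinger (-Complex.I) j (fun y => K.metric e y m k) z := by
  simp only [wirtinger, K.fderiv_metric he hz, single_I_eq]
  have hc (a b c : Cn n) := congrArg (fun r : ℝ => (r : ℂ)) (K.closed_apply he hz a b c)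
  set M : Cn n := Pi.single m 1
  set N : Cn n := Pi.single j 1
  set P : Cn n := Pi.single k 1
  have h1 := hc M N (Complex.I • P)
  have h2 := hc M N P
  have h3 := hc (Complex.I • M) (Complex.I • N) (Complex.I • P)
  have h4 := hc (Complex.I • M) (Complex.I • N) P
  simp only [K.fderiv_localForm_I_I he hz] at h3 h4
  simp only [K.fderiv_localForm_I_left he hz] at h4
  push_cast at h1 h2 h3 h4
  set A := ((fderiv ℝ (fun y => localForm K.form e y ![N, P]) z (Complex.I • M) : ℝ) : ℂ)
  set B := ((fderiv ℝ (fun y => localForm K.form e y ![M, P]) z (Complex.I • N) : ℝ) : ℂ)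
  linear_combination (1 / 4) * (h1 - Complex.I * h2 + Complex.I * h4 - h3) +
    (1 / 4) * (A - B) * Complex.I_mul_I

/-- The Kähler identity `∂g_{jk̄}/∂z̄_m = ∂g_{jm̄}/∂z̄_k`. -/
theorem dzbar_metric_symm (he : e ∈ atlas (Cn n) X) {z : Cn n} (hz : z ∈ e.target)
    (m j k : Fin n) : wirtinger Complex.I m (fun y => K.metric e y j k) z =
      wirtinger Complex.I k (fun y => K.metric e y j m) z := by
  simp only [wirtinger, K.fderiv_metric he hz, single_I_eq]
  have hc (a b c : Cn n) := congrArg (fun r : ℝ => (r : ℂ)) (K.closed_apply he hz a b c)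
  set M : Cn n := Pi.single m 1
  set N : Cn n := Pi.single j 1
  set P : Cn n := Pi.single k 1
  have h1 := hc M N (Complex.I • P)
  have h2 := hc P N (Complex.I • M)
  have h3 := hc M N P
  have h4 := hc (Complex.I • M) N (Complex.I • P)
  simp only [K.fderiv_localForm_I_I he hz, K.fderiv_localForm_I_left he hz] at h4
  rw [K.fderiv_localForm_swap e z M N] at h1 h3
  rw [K.fderiv_localForm_swap e z P N, K.fderiv_localForm_swap e z P (Complex.I • M),
    K.fderiv_localForm_I_left he hz M P] at h2
  rw [K.fderiv_localForm_swap e z M (Complex.I • N), K.fderiv_localForm_I_left he hz N M] at h4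
  push_cast at h1 h2 h3 h4
  set A := ((fderiv ℝ (fun y => localForm K.form e y ![N, P]) z (Complex.I • M) : ℝ) : ℂ)
  set B := ((fderiv ℝ (fun y => localForm K.form e y ![N, M]) z (Complex.I • P) : ℝ) : ℂ)
  linear_combination (1 / 4) * (h1 - h2 - Complex.I * h3 + Complex.I * h4) -
    (1 / 4) * (A - B) * Complex.I_mul_I

end KahlerForm

end Metric

/-! ### Integration against the volume form -/

section Integration

variable {n : ℕ} {X : Type*} [TopologicalSpace X] [ChartedSpace (Cn n) X]

/-- A function which is continuous in all preferred charts is continuous. -/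
theorem continuous_of_continuousOn_charts {F : X → ℂ}
    (h : ∀ i : X, ContinuousOn (fun z => F ((chartAt (Cn n) i).symm z)) (chartAt (Cn n) i).target) :
    Continuous F := by
  rw [continuous_iff_continuousAt]
  intro x
  set e := chartAt (Cn n) x with he
  have hx : x ∈ e.source := mem_chart_source (Cn n) x
  have h1 : ContinuousAt (fun z => F (e.symm z)) (e x) :=
    (h x).continuousAt (e.open_target.mem_nhds (e.map_source hx))
  have h2 : ContinuousAt (fun y => F (e.symm (e y))) x :=
    ContinuousAt.comp (g := fun z => F (e.symm z)) h1 (e.continuousAt hx)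
  refine h2.congr (Filter.eventuallyEq_of_mem (e.open_source.mem_nhds hx) fun y hy => ?_)
  simp only [e.left_inv hy]

/-- The coefficient of the volume form `F ωⁿ` in a chart. -/
def KahlerForm.density (K : KahlerForm n X) (F : X → ℂ) (e : OpenPartialHomeomorph X (Cn n))
    (z : Cn n) : ℂ :=
  F (e.symm z) * ((n.factorial : ℂ) * (K.metric e z).det * 2 ^ n)

/-- The absolute value of the real Jacobian determinant of a holomorphic map. -/
theorem abs_det_restrictScalars (L : Cn n →L[ℂ] Cn n) :
    |(L.restrictScalars ℝ).det| =
      Complex.normSq (LinearMap.toMatrix' (L : Cn n →ₗ[ℂ] Cn n)).det := by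
  have h : (L.restrictScalars ℝ).det =
      LinearMap.det ((L : Cn n →ₗ[ℂ] Cn n).restrictScalars ℝ) := rfl
  rw [h, LinearMap.det_restrictScalars, Algebra.norm_complex_apply, LinearMap.det_toMatrix',
    abs_of_nonneg (Complex.normSq_nonneg _)]

variable [IsManifold 𝓘(ℂ, Cn n) ω X]

theorem KahlerForm.contDiffOn_det_metric (K : KahlerForm n X) {e : OpenPartialHomeomorph X (Cn n)}
    (he : e ∈ atlas (Cn n) X) : ContDiffOn ℝ ∞ (fun z => (K.metric e z).det) e.target :=
  contDiffOn_det (K.contDiffOn_metric he)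

/-- Two charts give the same integral of a top form supported in both of them. -/
theorem KahlerForm.setIntegral_density_change (K : KahlerForm n X)
    {e e' : OpenPartialHomeomorph X (Cn n)} (he : e ∈ atlas (Cn n) X) (he' : e' ∈ atlas (Cn n) X)
    {F : X → ℂ} (hF : Function.support F ⊆ e.source ∩ e'.source) :
    ∫ z in e.target, K.density F e z = ∫ z in e'.target, K.density F e' z := by
  set Φ := e.symm ≫ₕ e' with hΦ
  have hsrc : ∀ z, z ∈ Φ.source ↔ z ∈ e.target ∧ e.symm z ∈ e'.source := fun z => by simp [hΦ]
  have htgt : ∀ z, z ∈ Φ.target ↔ z ∈ e'.target ∧ e'.symm z ∈ e.source := fun z => by simp [hΦ]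
  have h1 : ∫ z in e.target, K.density F e z = ∫ z in Φ.source, K.density F e z := by
    refine (setIntegral_eq_of_subset_of_forall_sdiff_eq_zero e.open_target.measurableSet
      (fun z hz => ((hsrc z).1 hz).1) fun z hz => ?_)
    have : F (e.symm z) = 0 := by
      by_contra h0
      exact hz.2 ((hsrc z).2 ⟨hz.1, (hF h0).2⟩)
    rw [density, this, zero_mul]
  have h2 : ∫ z in e'.target, K.density F e' z = ∫ z in Φ.target, K.density F e' z := by
    refine (setIntegral_eq_of_subset_of_forall_sdiff_eq_zero e'.open_target.measurableSet
      (fun z hz => ((htgt z).1 hz).1) fun z hz => ?_)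
    have : F (e'.symm z) = 0 := by
      by_contra h0
      exact hz.2 ((htgt z).2 ⟨hz.1, (hF h0).1⟩)
    rw [density, this, zero_mul]
  have hd : ∀ z ∈ Φ.source, HasFDerivAt Φ ((fderiv ℂ (fun y => e' (e.symm y)) z).restrictScalars ℝ)
      z := fun z hz =>
    ((((contDiffOn_transition he he').contDiffAt
      (Φ.open_source.mem_nhds hz)).differentiableAt (by simp)).hasFDerivAt).restrictScalars ℝ
  rw [h1, h2, integral_target_eq_integral_abs_det_fderiv_smul MeasureTheory.volume hd]
  refine setIntegral_congr_fun Φ.open_source.measurableSet fun z hz => ?_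
  have hx : e'.symm (e' (e.symm z)) = e.symm z := e'.left_inv ((hsrc z).1 hz).2
  simp only [abs_det_restrictScalars, density, hΦ, OpenPartialHomeomorph.coe_trans,
    Function.comp_apply, hx, K.metric_det_change he he' hz, Complex.real_smul, jacobian]
  ring

variable [CompactSpace X]

theorem KahlerForm.integrableOn_density (K : KahlerForm n X)
    {e : OpenPartialHomeomorph X (Cn n)} (he : e ∈ atlas (Cn n) X) {F : X → ℂ} (hF : Continuous F)
    (hs : tsupport F ⊆ e.source) : IntegrableOn (K.density F e) e.target := by
  have hT : IsCompact (e '' tsupport F) :=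
    (isClosed_tsupport F).isCompact.image_of_continuousOn (e.continuousOn.mono hs)
  have hTs : e '' tsupport F ⊆ e.target := by
    rintro _ ⟨x, hx, rfl⟩
    exact e.map_source (hs hx)
  have hc : ContinuousOn (K.density F e) e.target :=
    (hF.comp_continuousOn e.continuousOn_symm).mul
      ((continuousOn_const.mul (K.contDiffOn_det_metric he).continuousOn).mul continuousOn_const)
  refine ((hc.mono hTs).integrableOn_compact hT).of_forall_sdiff_eq_zero
    e.open_target.measurableSet fun z hz => ?_
  have : F (e.symm z) = 0 := by
    by_contra h0
    exact hz.2 ⟨e.symm z, subset_tsupport F h0, e.right_inv hz.1⟩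
  rw [density, this, zero_mul]

variable [T2Space X]

/-- The indices of the nonzero functions of the partition of unity. -/
def unityIndices (n : ℕ) (X : Type*) [TopologicalSpace X] [ChartedSpace (Cn n) X] [T2Space X]
    [CompactSpace X] [IsManifold 𝓘(ℂ, Cn n) ω X] : Finset X :=
  ((unityPartition n X).locallyFinite.finite_nonempty_of_compact).toFinset

theorem unityPartition_eq_zero {i : X} (hi : i ∉ unityIndices n X) (x : X) :
    unityPartition n X i x = 0 := by
  by_contra h
  exact hi ((Set.Finite.mem_toFinset _).2 ⟨x, h⟩)

theorem sum_unityPartition (x : X) : ∑ i ∈ unityIndices n X, unityPartition n X i x = 1 := by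
  rw [← (unityPartition n X).sum_eq_one (Set.mem_univ x)]
  refine (finsum_eq_sum_of_support_subset _ fun i hi => ?_).symm
  by_contra h
  exact hi (unityPartition_eq_zero h x)

/-- The product of `F` with a function of the partition of unity. -/
def cutoff (F : X → ℂ) (i : X) (x : X) : ℂ := (unityPartition n X i x : ℂ) * F x

theorem sum_cutoff (F : X → ℂ) (x : X) : ∑ i ∈ unityIndices n X, cutoff (n := n) F i x = F x := by
  simp only [cutoff]
  rw [← Finset.sum_mul, ← Complex.ofReal_sum, sum_unityPartition, Complex.ofReal_one, one_mul]

theorem continuous_cutoff {F : X → ℂ} (hF : Continuous F) (i : X) :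
    Continuous (cutoff (n := n) F i) :=
  (Complex.continuous_ofReal.comp (unityPartition n X i).contMDiff.continuous).mul hF

theorem tsupport_cutoff_subset (F : X → ℂ) (i : X) :
    tsupport (cutoff (n := n) F i) ⊆ (chartAt (Cn n) i).source := by
  refine subset_trans (closure_mono fun x hx => ?_) (unityPartition_isSubordinate n X i)
  intro h0
  apply hx
  rw [cutoff, h0, Complex.ofReal_zero, zero_mul]

/-- The integral `∫ F ωⁿ`. -/
def KahlerForm.volIntegral (K : KahlerForm n X) (F : X → ℂ) : ℂ := integral (fmul F K.volume)

theorem KahlerForm.volIntegral_eq_sum (K : KahlerForm n X) (F : X → ℂ) :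
    K.volIntegral F = ∑ i ∈ unityIndices n X, ∫ z in (chartAt (Cn n) i).target,
      K.density (cutoff (n := n) F i) (chartAt (Cn n) i) z := by
  have h (i : X) : (∫ z in (chartAt (Cn n) i).target,
      (unityPartition n X i ((chartAt (Cn n) i).symm z) : ℂ) *
        fmul F K.volume ((chartAt (Cn n) i).symm z) (frame (chartAt (Cn n) i) z)) =
      ∫ z in (chartAt (Cn n) i).target,
        K.density (cutoff (n := n) F i) (chartAt (Cn n) i) z := by
    congr 1
    funext z
    rw [density, cutoff, mul_assoc]
    rfl
  rw [volIntegral, integral, finsum_eq_sum_of_support_subset (s := unityIndices n X)]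
  · exact Finset.sum_congr rfl fun i _ => h i
  · intro i hi
    by_contra h0
    apply hi
    simp only [unityPartition_eq_zero h0, Complex.ofReal_zero, zero_mul, integral_zero]

theorem KahlerForm.volIntegral_add (K : KahlerForm n X) {F G : X → ℂ} (hF : Continuous F)
    (hG : Continuous G) :
    K.volIntegral (fun x => F x + G x) = K.volIntegral F + K.volIntegral G := by
  simp only [volIntegral_eq_sum]
  rw [← Finset.sum_add_distrib]
  refine Finset.sum_congr rfl fun i _ => ?_
  rw [← integral_add (K.integrableOn_density (chart_mem_atlas _ i) (continuous_cutoff hF i)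
    (tsupport_cutoff_subset F i)) (K.integrableOn_density (chart_mem_atlas _ i)
    (continuous_cutoff hG i) (tsupport_cutoff_subset G i))]
  congr 1
  funext z
  simp only [density, cutoff]
  ring

theorem KahlerForm.volIntegral_const_mul (K : KahlerForm n X) (c : ℂ) (F : X → ℂ) :
    K.volIntegral (fun x => c * F x) = c * K.volIntegral F := by
  simp only [volIntegral_eq_sum]
  rw [Finset.mul_sum]
  refine Finset.sum_congr rfl fun i _ => ?_
  rw [← integral_const_mul]
  congr 1
  funext z
  simp only [density, cutoff]
  ring

theorem KahlerForm.volIntegral_sum {ι : Type*} (K : KahlerForm n X) (s : Finset ι)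
    {F : ι → X → ℂ} (hF : ∀ i ∈ s, Continuous (F i)) :
    K.volIntegral (fun x => ∑ i ∈ s, F i x) = ∑ i ∈ s, K.volIntegral (F i) := by
  classical
  induction s using Finset.induction_on with
  | empty =>
    have := K.volIntegral_const_mul 0 fun _ => 0
    simpa using this
  | insert a s ha ih =>
    simp only [Finset.sum_insert ha]
    rw [K.volIntegral_add (hF a (by simp))
      (continuous_finsetSum s fun i hi => hF i (Finset.mem_insert_of_mem hi)),
      ih fun i hi => hF i (Finset.mem_insert_of_mem hi)]

/-- The integral of a top form supported in a coordinate domain is computed in the chart. -/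
theorem KahlerForm.volIntegral_eq_setIntegral (K : KahlerForm n X)
    {e : OpenPartialHomeomorph X (Cn n)} (he : e ∈ atlas (Cn n) X) {F : X → ℂ} (hF : Continuous F)
    (hs : tsupport F ⊆ e.source) : K.volIntegral F = ∫ z in e.target, K.density F e z := by
  have hsub (i : X) : Function.support (cutoff (n := n) F i) ⊆ Function.support F := fun x hx h0 =>
    hx (by rw [cutoff, h0, mul_zero])
  rw [volIntegral_eq_sum]
  have h1 (i : X) : ∫ z in (chartAt (Cn n) i).target,
      K.density (cutoff (n := n) F i) (chartAt (Cn n) i) z =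
      ∫ z in e.target, K.density (cutoff (n := n) F i) e z :=
    K.setIntegral_density_change (chart_mem_atlas _ i) he fun x hx =>
      ⟨tsupport_cutoff_subset F i (subset_tsupport _ hx), hs (subset_tsupport _ (hsub i hx))⟩
  simp only [h1]
  rw [← integral_finsetSum _ fun i _ => K.integrableOn_density he (continuous_cutoff hF i)
    ((closure_mono (hsub i)).trans hs)]
  congr 1
  funext z
  simp only [density]
  rw [← Finset.sum_mul, sum_cutoff]

/-- A nonnegative continuous function with vanishing integral is zero. -/
theorem KahlerForm.eq_zero_of_volIntegral_eq_zero (K : KahlerForm n X) {φ : X → ℝ}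
    (hφ : Continuous φ) (h0 : ∀ x, 0 ≤ φ x) (hI : K.volIntegral (fun x => (φ x : ℂ)) = 0) (x : X) :
    φ x = 0 := by
  set q : X → Cn n → ℝ := fun i z => unityPartition n X i ((chartAt (Cn n) i).symm z) *
    φ ((chartAt (Cn n) i).symm z) *
    (n.factorial * (K.metric (chartAt (Cn n) i) z).det.re * 2 ^ n) with hq
  have hqd (i : X) : ∀ z ∈ (chartAt (Cn n) i).target,
      K.density (cutoff (n := n) (fun x => (φ x : ℂ)) i) (chartAt (Cn n) i) z = (q i z : ℂ) := by
    intro z hz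
    simp only [hq, density, cutoff]
    push_cast
    rw [K.ofReal_metric_det_re (chart_mem_atlas _ i) hz]
  have hq0 (i : X) : ∀ z ∈ (chartAt (Cn n) i).target, 0 ≤ q i z := fun z hz =>
    mul_nonneg (mul_nonneg ((unityPartition n X).nonneg i _) (h0 _))
      (mul_nonneg (mul_nonneg (Nat.cast_nonneg _)
        (K.metric_det_re_pos (chart_mem_atlas _ i) hz).le) (by positivity))
  have hint (i : X) : ∫ z in (chartAt (Cn n) i).target,
      K.density (cutoff (n := n) (fun x => (φ x : ℂ)) i) (chartAt (Cn n) i) z =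
      ((∫ z in (chartAt (Cn n) i).target, q i z : ℝ) : ℂ) := by
    refine Eq.trans ?_ (integral_ofReal (𝕜 := ℂ) (f := q i))
    exact setIntegral_congr_fun (chartAt (Cn n) i).open_target.measurableSet (hqd i)
  have hqi (i : X) : IntegrableOn (q i) (chartAt (Cn n) i).target := by
    have := (K.integrableOn_density (chart_mem_atlas _ i)
      (continuous_cutoff (Complex.continuous_ofReal.comp hφ) i) (tsupport_cutoff_subset _ i)).re
    refine IntegrableOn.congr_fun this (fun z hz => ?_)
      (chartAt (Cn n) i).open_target.measurableSet
    change (K.density (cutoff (n := n) (fun x => (φ x : ℂ)) i) (chartAt (Cn n) i) z).re = q i z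
    rw [hqd i z hz, Complex.ofReal_re]
  rw [volIntegral_eq_sum] at hI
  simp only [hint] at hI
  rw [← Complex.ofReal_sum, Complex.ofReal_eq_zero, Finset.sum_eq_zero_iff_of_nonneg
    fun i _ => setIntegral_nonneg (chartAt (Cn n) i).open_target.measurableSet (hq0 i)] at hI
  -- some function of the partition of unity is positive at `x`
  obtain ⟨i, hi, hxi⟩ : ∃ i ∈ unityIndices n X, unityPartition n X i x ≠ 0 := by
    by_contra! hcon
    have := sum_unityPartition (n := n) x
    rw [Finset.sum_eq_zero hcon] at this
    exact zero_ne_one this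
  have hxs : x ∈ (chartAt (Cn n) i).source :=
    unityPartition_isSubordinate n X i (subset_tsupport _ hxi)
  set e := chartAt (Cn n) i with he
  have hae : q i =ᵐ[MeasureTheory.volume.restrict e.target] 0 :=
    (setIntegral_eq_zero_iff_of_nonneg_ae (ae_restrict_of_forall_mem
      e.open_target.measurableSet (hq0 i)) (hqi i)).1 (hI i hi)
  have hqc : ContinuousOn (q i) e.target :=
    (((unityPartition n X i).contMDiff.continuous.comp_continuousOn e.continuousOn_symm).mul
      (hφ.comp_continuousOn e.continuousOn_symm)).mul ((continuousOn_const.mul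
      (Complex.continuous_re.comp_continuousOn
        (K.contDiffOn_det_metric (chart_mem_atlas _ i)).continuousOn)).mul continuousOn_const)
  have hz : e x ∈ e.target := e.map_source hxs
  have h1 := Measure.eqOn_open_of_ae_eq hae e.open_target hqc continuousOn_const hz
  have hdet := K.metric_det_re_pos (chart_mem_atlas _ i) hz
  simp only [hq, Pi.zero_apply] at h1
  rw [← he, e.left_inv hxs] at h1
  have hfac : (0 : ℝ) < n.factorial * (K.metric e (e x)).det.re * 2 ^ n := by
    have : (0 : ℝ) < n.factorial := by exact_mod_cast n.factorial_pos
    positivity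
  rcases mul_eq_zero.1 h1 with h2 | h2
  · exact (mul_eq_zero.1 h2).resolve_left hxi
  · exact absurd h2 hfac.ne'

end Integration

/-! ### The Laplacian and integration by parts -/

section Green

variable {n : ℕ}

/-- The pointwise identity behind Green's formula, integrated: `h` is a matrix with divergence free
columns and `F` has compact support. -/
theorem setIntegral_green {s t : ℂ} {U T : Set (Cn n)} (hU : IsOpen U) (hT : IsCompact T)
    (hTU : T ⊆ U) {h : Cn n → Matrix (Fin n) (Fin n) ℂ}
    (hh : ∀ j k, ContDiffOn ℝ ∞ (fun z => h z j k) U)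
    (hdiv : ∀ z ∈ U, ∀ k, ∑ j, wirtinger s j (fun y => h y j k) z = 0) {F G : Cn n → ℂ}
    (hF : ContDiffOn ℝ ∞ F U) (hG : ContDiffOn ℝ ∞ G U) (hF0 : ∀ z ∈ U, z ∉ T → F z = 0) :
    ∫ z in U, ∑ j, ∑ k, (wirtinger s j F z * h z j k * wirtinger t k G z +
      F z * h z j k * wirtinger s j (wirtinger t k G) z) = 0 := by
  have hGt (k : Fin n) : ContDiffOn ℝ ∞ (wirtinger t k G) U := contDiffOn_wirtinger hU hG
  have hd {φ : Cn n → ℂ} (h : ContDiffOn ℝ ∞ φ U) {z : Cn n} (hz : z ∈ U) :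
      DifferentiableAt ℝ φ z := (h.contDiffAt (hU.mem_nhds hz)).differentiableAt (by simp)
  have hw (j k : Fin n) : ContDiffOn ℝ ∞ (fun z => h z j k * wirtinger t k G z) U :=
    (hh j k).mul (hGt k)
  have hW (j : Fin n) : ContDiffOn ℝ ∞ (fun z => ∑ k, h z j k * wirtinger t k G z) U :=
    ContDiffOn.sum fun k _ => hw j k
  have hFW (j : Fin n) : ContDiffOn ℝ ∞ (fun z => F z * ∑ k, h z j k * wirtinger t k G z) U :=
    hF.mul (hW j)
  have h1 : ∀ z ∈ U, ∑ j, ∑ k, (wirtinger s j F z * h z j k * wirtinger t k G z +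
      F z * h z j k * wirtinger s j (wirtinger t k G) z) =
      ∑ j, wirtinger s j (fun z => F z * ∑ k, h z j k * wirtinger t k G z) z := by
    intro z hz
    have h2 (j : Fin n) : wirtinger s j (fun z => F z * ∑ k, h z j k * wirtinger t k G z) z =
        ∑ k, (wirtinger s j F z * h z j k * wirtinger t k G z +
          F z * h z j k * wirtinger s j (wirtinger t k G) z) +
        ∑ k, F z * wirtinger t k G z * wirtinger s j (fun y => h y j k) z := by
      rw [wirtinger_mul (hd hF hz) (hd (hW j) hz), wirtinger_sum fun k _ => hd (hw j k) hz,
        Finset.mul_sum, Finset.mul_sum, ← Finset.sum_add_distrib, ← Finset.sum_add_distrib]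
      refine Finset.sum_congr rfl fun k _ => ?_
      rw [wirtinger_mul (hd (hh j k) hz) (hd (hGt k) hz)]
      ring
    simp only [h2]
    rw [Finset.sum_add_distrib, Finset.sum_comm (f := fun j k => F z * wirtinger t k G z * _)]
    simp only [← Finset.mul_sum, hdiv z hz, mul_zero, Finset.sum_const_zero, add_zero]
  -- the integrability of each term of the divergence
  have hint (j : Fin n) : IntegrableOn
      (wirtinger s j (fun z => F z * ∑ k, h z j k * wirtinger t k G z)) U := by
    have hc := (contDiffOn_wirtinger (s := s) (j := j) hU (hFW j)).continuousOn
    refine ((hc.mono hTU).integrableOn_compact hT).of_forall_sdiff_eq_zero hU.measurableSet ?_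
    intro z hz
    rw [wirtinger_congr_of_eqOn (U := U \ T) (ψ := fun _ => 0) (hU.sdiff hT.isClosed)
      (fun y hy => by simp only [hF0 y hy.1 hy.2, zero_mul]) hz, wirtinger_const]
  rw [setIntegral_congr_fun hU.measurableSet h1, integral_finsetSum _ fun j _ => hint j]
  exact Finset.sum_eq_zero fun j _ => setIntegral_wirtinger_eq_zero hU hT hTU (hFW j)
    fun z hz hzT => by simp only [hF0 z hz hzT, zero_mul]

/-- Traces against the inverse metric are invariant under changes of frame. -/
theorem trace_inv_mul_change {A g M : Matrix (Fin n) (Fin n) ℂ}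
    (h : (A.transpose * g * A.map star).det ≠ 0) :
    ((A.transpose * g * A.map star)⁻¹ * (A.transpose * M * A.map star)).trace =
      (g⁻¹ * M).trace := by
  rw [Matrix.det_mul, Matrix.det_mul] at h
  have h1 : IsUnit A.transpose.det := (left_ne_zero_of_mul (left_ne_zero_of_mul h)).isUnit
  have h2 : IsUnit (A.map star).det := (right_ne_zero_of_mul h).isUnit
  rw [Matrix.mul_inv_rev, Matrix.mul_inv_rev, Matrix.trace_mul_comm]
  have : A.transpose * M * A.map star * ((A.map star)⁻¹ * (g⁻¹ * (A.transpose)⁻¹)) =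
      A.transpose * (M * (g⁻¹ * (A.transpose)⁻¹)) := by
    rw [Matrix.mul_assoc, Matrix.mul_assoc, ← Matrix.mul_assoc (A.map star),
      Matrix.mul_nonsing_inv _ h2, Matrix.one_mul]
  rw [this, Matrix.trace_mul_comm, Matrix.mul_assoc, Matrix.mul_assoc,
    Matrix.nonsing_inv_mul _ h1, Matrix.mul_one, Matrix.trace_mul_comm]

/-- The matrix `(∂F/∂z_j · ∂G/∂z̄_k)`. -/
def gradMatrix (F G : Cn n → ℂ) (z : Cn n) : Matrix (Fin n) (Fin n) ℂ :=
  Matrix.of fun j k => dz j F z * dzbar k G z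

theorem gradMatrix_comp {F G : Cn n → ℂ} {Φ : Cn n → Cn n} {z : Cn n}
    (hΦ : DifferentiableAt ℂ Φ z) (hF : DifferentiableAt ℝ F (Φ z))
    (hG : DifferentiableAt ℝ G (Φ z)) :
    gradMatrix (fun y => F (Φ y)) (fun y => G (Φ y)) z =
      (jacobian Φ z).transpose * gradMatrix F G (Φ z) * (jacobian Φ z).map star := by
  ext j k
  simp only [gradMatrix, Matrix.of_apply, dz_comp hΦ hF, dzbar_comp hΦ hG, Matrix.mul_apply,
    Matrix.transpose_apply, Matrix.map_apply, Finset.sum_mul, Finset.mul_sum]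
  refine Finset.sum_congr rfl fun l _ => Finset.sum_congr rfl fun m _ => by ring

end Green

section Laplacian

variable {n : ℕ} {X : Type*} [TopologicalSpace X] [ChartedSpace (Cn n) X]

theorem differentiableAt_comp_symm [IsManifold 𝓘(ℂ, Cn n) ω X]
    {e : OpenPartialHomeomorph X (Cn n)} (he : e ∈ atlas (Cn n) X) {z : Cn n} (hz : z ∈ e.target)
    {F : X → ℂ} (hF : ContMDiff 𝓘(ℝ, Cn n) 𝓘(ℝ, ℂ) ∞ F) :
    DifferentiableAt ℝ (fun y => F (e.symm y)) z :=
  ((contDiffOn_comp_symm he hF).contDiffAt (e.open_target.mem_nhds hz)).differentiableAt (by simp)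

theorem contMDiff_mul {F G : X → ℂ} (hF : ContMDiff 𝓘(ℝ, Cn n) 𝓘(ℝ, ℂ) ∞ F)
    (hG : ContMDiff 𝓘(ℝ, Cn n) 𝓘(ℝ, ℂ) ∞ G) :
    ContMDiff 𝓘(ℝ, Cn n) 𝓘(ℝ, ℂ) ∞ (fun x => F x * G x) :=
  (contDiff_mul (𝕜 := ℝ) (𝔸 := ℂ)).comp_contMDiff (hF.prodMk_space hG)

namespace KahlerForm

variable (K : KahlerForm n X)

/-- The `∂̄`-Laplacian `∑ g^{jk̄} ∂²G/∂z_j∂z̄_k`, computed in the preferred chart at the point. -/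
def laplacian (G : X → ℂ) (x : X) : ℂ :=
  ((K.metric (chartAt (Cn n) x) (chartAt (Cn n) x x))⁻¹ *
    ddbar (fun y => G ((chartAt (Cn n) x).symm y)) (chartAt (Cn n) x x)).trace

/-- The pairing `∑ g^{jk̄} ∂F/∂z_j ∂G/∂z̄_k` of `∂F` and `∂̄G`, computed in the preferred chart at
the point. -/
def pairing (F G : X → ℂ) (x : X) : ℂ :=
  ((K.metric (chartAt (Cn n) x) (chartAt (Cn n) x x))⁻¹ *
    gradMatrix (fun y => F ((chartAt (Cn n) x).symm y))
      (fun y => G ((chartAt (Cn n) x).symm y)) (chartAt (Cn n) x x)).trace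

theorem pairing_eq_zero_left {F : X → ℂ} (G : X → ℂ) {x : X} (hx : x ∉ tsupport F) :
    K.pairing F G x = 0 := by
  set e := chartAt (Cn n) x with he
  have hxs : x ∈ e.source := mem_chart_source (Cn n) x
  have h0 : (fun y => F (e.symm y)) =ᶠ[nhds (e x)] fun _ => 0 := by
    have : ∀ᶠ y in nhds x, F y = 0 := notMem_tsupport_iff_eventuallyEq.1 hx
    have hc := e.continuousAt_symm (e.map_source hxs)
    rw [ContinuousAt, e.left_inv hxs] at hc
    exact hc.eventually this
  have h1 : gradMatrix (fun y => F (e.symm y)) (fun y => G (e.symm y)) (e x) = 0 := by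
    ext j k
    simp only [gradMatrix, Matrix.of_apply, dz_eq_wirtinger]
    rw [wirtinger_congr h0, wirtinger_const, zero_mul, Matrix.zero_apply]
  rw [pairing, ← he, h1, Matrix.mul_zero, Matrix.trace_zero]

theorem pairing_eq_zero_right {F : X → ℂ} (G : X → ℂ) {x : X} (hx : x ∉ tsupport F) :
    K.pairing G F x = 0 := by
  set e := chartAt (Cn n) x with he
  have hxs : x ∈ e.source := mem_chart_source (Cn n) x
  have h0 : (fun y => F (e.symm y)) =ᶠ[nhds (e x)] fun _ => 0 := by
    have : ∀ᶠ y in nhds x, F y = 0 := notMem_tsupport_iff_eventuallyEq.1 hx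
    have hc := e.continuousAt_symm (e.map_source hxs)
    rw [ContinuousAt, e.left_inv hxs] at hc
    exact hc.eventually this
  have h1 : gradMatrix (fun y => G (e.symm y)) (fun y => F (e.symm y)) (e x) = 0 := by
    ext j k
    simp only [gradMatrix, Matrix.of_apply, dzbar_eq_wirtinger]
    rw [wirtinger_congr h0, wirtinger_const, mul_zero, Matrix.zero_apply]
  rw [pairing, ← he, h1, Matrix.mul_zero, Matrix.trace_zero]

variable [IsManifold 𝓘(ℂ, Cn n) ω X] {e : OpenPartialHomeomorph X (Cn n)}

/-- An expression `tr (g⁻¹ M)` in which `M` transforms like the metric takes the same value in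
every chart. -/
theorem trace_inv_metric_mul_change {e' : OpenPartialHomeomorph X (Cn n)}
    (he : e ∈ atlas (Cn n) X) (he' : e' ∈ atlas (Cn n) X) {z : Cn n}
    (hz : z ∈ (e.symm ≫ₕ e').source) {M M' : Matrix (Fin n) (Fin n) ℂ}
    (hM : M = (jacobian (fun y => e' (e.symm y)) z).transpose * M' *
      (jacobian (fun y => e' (e.symm y)) z).map star) :
    ((K.metric e z)⁻¹ * M).trace = ((K.metric e' (e' (e.symm z)))⁻¹ * M').trace := by
  have hz' : z ∈ e.target ∧ e.symm z ∈ e'.source := by simpa using hz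
  have h := K.metric_det_ne_zero he hz'.1
  rw [K.metric_change he he' hz] at h
  rw [K.metric_change he he' hz, hM, trace_inv_mul_change h]

/-- The Laplacian can be computed in any chart. -/
theorem laplacian_symm_apply (he : e ∈ atlas (Cn n) X) {z : Cn n} (hz : z ∈ e.target) {G : X → ℂ}
    (hG : ContMDiff 𝓘(ℝ, Cn n) 𝓘(ℝ, ℂ) ∞ G) :
    K.laplacian G (e.symm z) =
      ((K.metric e z)⁻¹ * ddbar (fun y => G (e.symm y)) z).trace := by
  set e' := chartAt (Cn n) (e.symm z) with he'
  have he'a : e' ∈ atlas (Cn n) X := chart_mem_atlas _ _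
  have hz' : z ∈ (e.symm ≫ₕ e').source := by simp [hz, he']
  refine (K.trace_inv_metric_mul_change he he'a hz' ?_).symm
  rw [← ddbar_comp (φ := fun y => G (e'.symm y)) (e.symm ≫ₕ e').open_source e'.open_target
    (contDiffOn_transition he he'a) (fun y hy => e'.map_source (by simpa using! hy.2))
    (contDiffOn_comp_symm he'a hG) hz']
  ext j k
  have hE : Set.EqOn (fun y => G (e.symm y)) (fun y => G (e'.symm (e' (e.symm y))))
      (e.symm ≫ₕ e').source := fun y hy => by
    have hy' : e.symm y ∈ e'.source := hy.2
    simp only [e'.left_inv hy']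
  rw [ddbar, ddbar, Matrix.of_apply, Matrix.of_apply, dz_eq_wirtinger, dz_eq_wirtinger]
  refine wirtinger_congr_of_eqOn (e.symm ≫ₕ e').open_source (fun y hy => ?_) hz'
  exact wirtinger_congr_of_eqOn (e.symm ≫ₕ e').open_source hE hy

/-- The pairing can be computed in any chart. -/
theorem pairing_symm_apply (he : e ∈ atlas (Cn n) X) {z : Cn n} (hz : z ∈ e.target) {F G : X → ℂ}
    (hF : ContMDiff 𝓘(ℝ, Cn n) 𝓘(ℝ, ℂ) ∞ F) (hG : ContMDiff 𝓘(ℝ, Cn n) 𝓘(ℝ, ℂ) ∞ G) :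
    K.pairing F G (e.symm z) = ((K.metric e z)⁻¹ *
      gradMatrix (fun y => F (e.symm y)) (fun y => G (e.symm y)) z).trace := by
  set e' := chartAt (Cn n) (e.symm z) with he'
  have he'a : e' ∈ atlas (Cn n) X := chart_mem_atlas _ _
  have hz' : z ∈ (e.symm ≫ₕ e').source := by simp [hz, he']
  have hxs : e' (e.symm z) ∈ e'.target := e'.map_source hz'.2
  have hd {H : X → ℂ} (hH : ContMDiff 𝓘(ℝ, Cn n) 𝓘(ℝ, ℂ) ∞ H) :
      DifferentiableAt ℝ (fun y => H (e'.symm y)) (e' (e.symm z)) :=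
    ((contDiffOn_comp_symm he'a hH).contDiffAt (e'.open_target.mem_nhds hxs)).differentiableAt
      (by simp)
  refine (K.trace_inv_metric_mul_change he he'a hz' ?_).symm
  rw [← gradMatrix_comp (F := fun y => F (e'.symm y)) (G := fun y => G (e'.symm y))
    (((contDiffOn_transition he he'a).contDiffAt ((e.symm ≫ₕ e').open_source.mem_nhds
      hz')).differentiableAt (by simp)) (hd hF) (hd hG)]
  ext j k
  have hE (H : X → ℂ) : Set.EqOn (fun y => H (e.symm y)) (fun y => H (e'.symm (e' (e.symm y))))
      (e.symm ≫ₕ e').source := fun y hy => by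
    have hy' : e.symm y ∈ e'.source := hy.2
    simp only [e'.left_inv hy']
  simp only [gradMatrix, Matrix.of_apply, dz_eq_wirtinger, dzbar_eq_wirtinger]
  rw [wirtinger_congr_of_eqOn (e.symm ≫ₕ e').open_source (hE F) hz',
    wirtinger_congr_of_eqOn (e.symm ≫ₕ e').open_source (hE G) hz']

theorem continuous_laplacian {G : X → ℂ} (hG : ContMDiff 𝓘(ℝ, Cn n) 𝓘(ℝ, ℂ) ∞ G) :
    Continuous (K.laplacian G) := by
  refine continuous_of_continuousOn_charts (n := n) fun i => ?_
  have he := chart_mem_atlas (Cn n) i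
  set e := chartAt (Cn n) i
  refine ContinuousOn.congr ?_ fun z hz => K.laplacian_symm_apply he hz hG
  simp only [Matrix.trace, Matrix.diag, Matrix.mul_apply]
  refine continuousOn_finsetSum _ fun k _ => continuousOn_finsetSum _ fun j _ => ?_
  refine (contDiffOn_matrix_inv (K.contDiffOn_metric he)
    (fun y hy => K.metric_det_ne_zero he hy) k j).continuousOn.mul ?_
  have : ContDiffOn ℝ ∞ (dz j (dzbar k (fun y => G (e.symm y)))) e.target := by
    rw [dz_eq_wirtinger]
    exact contDiffOn_wirtinger e.open_target
      (contDiffOn_wirtinger e.open_target (contDiffOn_comp_symm he hG))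
  exact this.continuousOn

theorem continuous_pairing {F G : X → ℂ} (hF : ContMDiff 𝓘(ℝ, Cn n) 𝓘(ℝ, ℂ) ∞ F)
    (hG : ContMDiff 𝓘(ℝ, Cn n) 𝓘(ℝ, ℂ) ∞ G) : Continuous (K.pairing F G) := by
  refine continuous_of_continuousOn_charts (n := n) fun i => ?_
  have he := chart_mem_atlas (Cn n) i
  set e := chartAt (Cn n) i
  refine ContinuousOn.congr ?_ fun z hz => K.pairing_symm_apply he hz hF hG
  simp only [Matrix.trace, Matrix.diag, Matrix.mul_apply]
  refine continuousOn_finsetSum _ fun k _ => continuousOn_finsetSum _ fun j _ => ?_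
  refine (contDiffOn_matrix_inv (K.contDiffOn_metric he)
    (fun y hy => K.metric_det_ne_zero he hy) k j).continuousOn.mul ?_
  have h1 : ContDiffOn ℝ ∞ (dz j (fun y => F (e.symm y))) e.target := by
    rw [dz_eq_wirtinger]
    exact contDiffOn_wirtinger e.open_target (contDiffOn_comp_symm he hF)
  have h2 : ContDiffOn ℝ ∞ (dzbar k (fun y => G (e.symm y))) e.target :=
    contDiffOn_wirtinger e.open_target (contDiffOn_comp_symm he hG)
  exact h1.continuousOn.mul h2.continuousOn

variable [CompactSpace X] [T2Space X]

theorem contMDiff_cutoff {F : X → ℂ} (hF : ContMDiff 𝓘(ℝ, Cn n) 𝓘(ℝ, ℂ) ∞ F) (i : X) :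
    ContMDiff 𝓘(ℝ, Cn n) 𝓘(ℝ, ℂ) ∞ (cutoff (n := n) F i) :=
  contMDiff_mul (Complex.ofRealCLM.contDiff.comp_contMDiff (unityPartition n X i).contMDiff) hF

theorem pairing_sum_cutoff_left {F G : X → ℂ} (hF : ContMDiff 𝓘(ℝ, Cn n) 𝓘(ℝ, ℂ) ∞ F)
    (x : X) : ∑ i ∈ unityIndices n X, K.pairing (cutoff (n := n) F i) G x = K.pairing F G x := by
  simp only [pairing]
  rw [← Matrix.trace_sum, ← Matrix.mul_sum]
  congr 2
  have hz := (chartAt (Cn n) x).map_source (mem_chart_source (Cn n) x)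
  have he := chart_mem_atlas (Cn n) x
  set e := chartAt (Cn n) x
  ext j k
  rw [Matrix.sum_apply]
  simp only [gradMatrix, Matrix.of_apply, dz_eq_wirtinger]
  rw [← Finset.sum_mul, ← wirtinger_sum fun i _ =>
    differentiableAt_comp_symm he hz (contMDiff_cutoff hF i)]
  simp only [sum_cutoff]

theorem pairing_sum_cutoff_right {F G : X → ℂ} (hF : ContMDiff 𝓘(ℝ, Cn n) 𝓘(ℝ, ℂ) ∞ F)
    (x : X) : ∑ i ∈ unityIndices n X, K.pairing G (cutoff (n := n) F i) x = K.pairing G F x := by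
  simp only [pairing]
  rw [← Matrix.trace_sum, ← Matrix.mul_sum]
  congr 2
  have hz := (chartAt (Cn n) x).map_source (mem_chart_source (Cn n) x)
  have he := chart_mem_atlas (Cn n) x
  set e := chartAt (Cn n) x
  ext j k
  rw [Matrix.sum_apply]
  simp only [gradMatrix, Matrix.of_apply, dzbar_eq_wirtinger]
  rw [← Finset.mul_sum, ← wirtinger_sum fun i _ =>
    differentiableAt_comp_symm he hz (contMDiff_cutoff hF i)]
  simp only [sum_cutoff]

/-- Green's formula when `F` is supported in a coordinate domain.  In the chart the volume density
is a multiple of `det g`, and `det g · g⁻¹` is divergence free because `ω` is closed. -/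
theorem volIntegral_green_of_tsupport_subset (he : e ∈ atlas (Cn n) X) {F G : X → ℂ}
    (hF : ContMDiff 𝓘(ℝ, Cn n) 𝓘(ℝ, ℂ) ∞ F) (hG : ContMDiff 𝓘(ℝ, Cn n) 𝓘(ℝ, ℂ) ∞ G)
    (hs : tsupport F ⊆ e.source) :
    K.volIntegral (fun x => F x * K.laplacian G x + K.pairing F G x) = 0 := by
  have hsupp : tsupport (fun x => F x * K.laplacian G x + K.pairing F G x) ⊆ tsupport F := by
    refine closure_minimal (fun x hx => ?_) (isClosed_tsupport F)
    by_contra h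
    apply hx
    simp only [image_eq_zero_of_notMem_tsupport h, K.pairing_eq_zero_left G h, zero_mul, add_zero]
  rw [K.volIntegral_eq_setIntegral (F := fun x => F x * K.laplacian G x + K.pairing F G x) he
    ((hF.continuous.mul (K.continuous_laplacian hG)).add (K.continuous_pairing hF hG))
    (hsupp.trans hs)]
  have hT : IsCompact (e '' tsupport F) :=
    (isClosed_tsupport F).isCompact.image_of_continuousOn (e.continuousOn.mono hs)
  have hTs : e '' tsupport F ⊆ e.target := by
    rintro _ ⟨x, hx, rfl⟩
    exact e.map_source (hs hx)
  have h := setIntegral_green (s := -Complex.I) (t := Complex.I) e.open_target hT hTs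
    (h := fun z => Matrix.of fun j k => (K.metric e z).det * (K.metric e z)⁻¹ k j)
    (fun j k => (K.contDiffOn_det_metric he).mul (contDiffOn_matrix_inv (K.contDiffOn_metric he)
      (fun y hy => K.metric_det_ne_zero he hy) k j))
    (fun z hz k => sum_wirtinger_det_mul_inv e.open_target (K.contDiffOn_metric he)
      (fun y hy => K.metric_det_ne_zero he hy) hz (fun m j k => K.dz_metric_symm he hz m j k) k)
    (contDiffOn_comp_symm he hF) (contDiffOn_comp_symm he hG) (fun z hz hzT => by
      by_contra h0
      exact hzT ⟨e.symm z, subset_tsupport F h0, e.right_inv hz⟩)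
  rw [setIntegral_congr_fun (g := fun z => (n.factorial * 2 ^ n : ℂ) * _)
    e.open_target.measurableSet fun z hz => ?_, integral_const_mul, h, mul_zero]
  simp only [density, K.laplacian_symm_apply he hz hG, K.pairing_symm_apply he hz hF hG,
    Matrix.trace, Matrix.diag, Matrix.mul_apply, Matrix.of_apply, gradMatrix, ddbar,
    dz_eq_wirtinger, dzbar_eq_wirtinger, Finset.mul_sum, Finset.sum_mul,
    ← Finset.sum_add_distrib]
  rw [Finset.sum_comm]
  exact Finset.sum_congr rfl fun j _ => Finset.sum_congr rfl fun k _ => by ring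

/-- The formula `volIntegral_green_of_tsupport_subset` with the roles of `∂` and `∂̄` exchanged. -/
theorem volIntegral_green'_of_tsupport_subset (he : e ∈ atlas (Cn n) X) {F G : X → ℂ}
    (hF : ContMDiff 𝓘(ℝ, Cn n) 𝓘(ℝ, ℂ) ∞ F) (hG : ContMDiff 𝓘(ℝ, Cn n) 𝓘(ℝ, ℂ) ∞ G)
    (hs : tsupport F ⊆ e.source) :
    K.volIntegral (fun x => F x * K.laplacian G x + K.pairing G F x) = 0 := by
  have hsupp : tsupport (fun x => F x * K.laplacian G x + K.pairing G F x) ⊆ tsupport F := by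
    refine closure_minimal (fun x hx => ?_) (isClosed_tsupport F)
    by_contra h
    apply hx
    simp only [image_eq_zero_of_notMem_tsupport h, K.pairing_eq_zero_right G h, zero_mul, add_zero]
  rw [K.volIntegral_eq_setIntegral (F := fun x => F x * K.laplacian G x + K.pairing G F x) he
    ((hF.continuous.mul (K.continuous_laplacian hG)).add (K.continuous_pairing hG hF))
    (hsupp.trans hs)]
  have hT : IsCompact (e '' tsupport F) :=
    (isClosed_tsupport F).isCompact.image_of_continuousOn (e.continuousOn.mono hs)
  have hTs : e '' tsupport F ⊆ e.target := by
    rintro _ ⟨x, hx, rfl⟩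
    exact e.map_source (hs hx)
  have h := setIntegral_green (s := Complex.I) (t := -Complex.I) e.open_target hT hTs
    (h := fun z => Matrix.of fun k j => (K.metric e z).det * (K.metric e z)⁻¹ k j)
    (fun k j => (K.contDiffOn_det_metric he).mul (contDiffOn_matrix_inv (K.contDiffOn_metric he)
      (fun y hy => K.metric_det_ne_zero he hy) k j))
    (fun z hz j => sum_wirtinger_det_mul_inv' e.open_target (K.contDiffOn_metric he)
      (fun y hy => K.metric_det_ne_zero he hy) hz
      (fun m j k => K.dzbar_metric_symm he hz m j k) j)
    (contDiffOn_comp_symm he hF) (contDiffOn_comp_symm he hG) (fun z hz hzT => by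
      by_contra h0
      exact hzT ⟨e.symm z, subset_tsupport F h0, e.right_inv hz⟩)
  rw [setIntegral_congr_fun (g := fun z => (n.factorial * 2 ^ n : ℂ) * _)
    e.open_target.measurableSet fun z hz => ?_, integral_const_mul, h, mul_zero]
  simp only [density, K.laplacian_symm_apply he hz hG, K.pairing_symm_apply he hz hG hF,
    Matrix.trace, Matrix.diag, Matrix.mul_apply, Matrix.of_apply, gradMatrix, ddbar,
    dz_eq_wirtinger, dzbar_eq_wirtinger, Finset.mul_sum, Finset.sum_mul,
    ← Finset.sum_add_distrib]
  refine Finset.sum_congr rfl fun k _ => Finset.sum_congr rfl fun j _ => ?_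
  rw [wirtinger_comm e.open_target (contDiffOn_comp_symm he hG) hz]
  ring

/-- Green's formula `∫ F ΔG ωⁿ = -∫ ⟨∂F, ∂̄G⟩ ωⁿ`. -/
theorem volIntegral_mul_laplacian {F G : X → ℂ} (hF : ContMDiff 𝓘(ℝ, Cn n) 𝓘(ℝ, ℂ) ∞ F)
    (hG : ContMDiff 𝓘(ℝ, Cn n) 𝓘(ℝ, ℂ) ∞ G) :
    K.volIntegral (fun x => F x * K.laplacian G x) = -K.volIntegral (K.pairing F G) := by
  rw [eq_neg_iff_add_eq_zero, ← K.volIntegral_add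
    (F := fun x => F x * K.laplacian G x) (hF.continuous.mul (K.continuous_laplacian hG))
    (K.continuous_pairing hF hG)]
  have h : (fun x => F x * K.laplacian G x + K.pairing F G x) = fun x =>
      ∑ i ∈ unityIndices n X, (cutoff (n := n) F i x * K.laplacian G x +
        K.pairing (cutoff (n := n) F i) G x) := by
    funext x
    rw [Finset.sum_add_distrib, ← Finset.sum_mul, sum_cutoff, K.pairing_sum_cutoff_left hF]
  rw [h, K.volIntegral_sum (F := fun i x => cutoff (n := n) F i x * K.laplacian G x +
    K.pairing (cutoff (n := n) F i) G x) _ fun i _ => ((contMDiff_cutoff hF i).continuous.mul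
    (K.continuous_laplacian hG)).add (K.continuous_pairing (contMDiff_cutoff hF i) hG)]
  exact Finset.sum_eq_zero fun i _ => K.volIntegral_green_of_tsupport_subset
    (chart_mem_atlas _ i) (contMDiff_cutoff hF i) hG (tsupport_cutoff_subset F i)

/-- Green's formula `∫ F ΔG ωⁿ = -∫ ⟨∂G, ∂̄F⟩ ωⁿ`. -/
theorem volIntegral_mul_laplacian' {F G : X → ℂ} (hF : ContMDiff 𝓘(ℝ, Cn n) 𝓘(ℝ, ℂ) ∞ F)
    (hG : ContMDiff 𝓘(ℝ, Cn n) 𝓘(ℝ, ℂ) ∞ G) :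
    K.volIntegral (fun x => F x * K.laplacian G x) = -K.volIntegral (K.pairing G F) := by
  rw [eq_neg_iff_add_eq_zero, ← K.volIntegral_add
    (F := fun x => F x * K.laplacian G x) (hF.continuous.mul (K.continuous_laplacian hG))
    (K.continuous_pairing hG hF)]
  have h : (fun x => F x * K.laplacian G x + K.pairing G F x) = fun x =>
      ∑ i ∈ unityIndices n X, (cutoff (n := n) F i x * K.laplacian G x +
        K.pairing G (cutoff (n := n) F i) x) := by
    funext x
    rw [Finset.sum_add_distrib, ← Finset.sum_mul, sum_cutoff, K.pairing_sum_cutoff_right hF]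
  rw [h, K.volIntegral_sum (F := fun i x => cutoff (n := n) F i x * K.laplacian G x +
    K.pairing G (cutoff (n := n) F i) x) _ fun i _ => ((contMDiff_cutoff hF i).continuous.mul
    (K.continuous_laplacian hG)).add (K.continuous_pairing hG (contMDiff_cutoff hF i))]
  exact Finset.sum_eq_zero fun i _ => K.volIntegral_green'_of_tsupport_subset
    (chart_mem_atlas _ i) (contMDiff_cutoff hF i) hG (tsupport_cutoff_subset F i)

end KahlerForm

end Laplacian

/-! ### Holomorphic vector fields and Hamiltonian functions -/

section HamiltonianFields

variable {n : ℕ} {X : Type*} [TopologicalSpace X] [ChartedSpace (Cn n) X]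
  [IsManifold 𝓘(ℂ, Cn n) ω X]

/-- A function on a compact connected complex manifold which is holomorphic in all preferred
charts is constant. -/
theorem exists_eq_const_of_differentiableAt_charts [CompactSpace X] [ConnectedSpace X] {F : X → ℂ}
    (h : ∀ i : X, ∀ z ∈ (chartAt (Cn n) i).target,
      DifferentiableAt ℂ (fun y => F ((chartAt (Cn n) i).symm y)) z) : ∃ c, ∀ x, F x = c := by
  have : IsManifold 𝓘(ℂ, Cn n) 1 X := IsManifold.of_le (n := ω) le_top
  have hm : MDifferentiable 𝓘(ℂ, Cn n) 𝓘(ℂ, ℂ) F := by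
    intro x
    have hx := mem_chart_source (Cn n) x
    have he := chart_mem_atlas (Cn n) x
    have hz := h x
    set e := chartAt (Cn n) x
    have h1 := (hz (e x) (e.map_source hx)).mdifferentiableAt.comp x
      (mdifferentiableAt_atlas (I := 𝓘(ℂ, Cn n)) he hx)
    refine h1.congr_of_eventuallyEq (Filter.eventuallyEq_of_mem (e.open_source.mem_nhds hx)
      fun y hy => ?_)
    simp only [Function.comp_apply, e.left_inv hy]
  obtain ⟨c, hc⟩ := hm.exists_eq_const_of_compactSpace
  exact ⟨c, fun x => congrFun hc x⟩

/-- In a chart `v(F) = ∑ vˡ ∂F/∂z_l`. -/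
theorem along_symm_apply (v : ∀ x : X, CT n x) {e : OpenPartialHomeomorph X (Cn n)}
    (he : e ∈ atlas (Cn n) X) {z : Cn n} (hz : z ∈ e.target) {F : X → ℂ}
    (hF : ContMDiff 𝓘(ℝ, Cn n) 𝓘(ℝ, ℂ) ∞ F) :
    along v F (e.symm z) = ∑ l, components v e z l * dz l (fun y => F (e.symm y)) z := by
  rw [along, ← chartPush_components v he hz, J_chartPush he hz, diff_chartPush he hz hF,
    diff_chartPush he hz hF, fderiv_apply_eq_sum, fderiv_apply_eq_sum, Finset.mul_sum,
    ← Finset.sum_sub_distrib, Finset.mul_sum]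
  refine Finset.sum_congr rfl fun l _ => ?_
  simp only [Pi.smul_apply, smul_eq_mul, star_mul', Complex.star_def, Complex.conj_I]
  linear_combination (1 / 2 * (-components v e z l * dz l (fun y => F (e.symm y)) z +
    (starRingEnd ℂ) (components v e z l) * dzbar l (fun y => F (e.symm y)) z)) * Complex.I_mul_I

namespace KahlerForm

variable (K : KahlerForm n X) {e : OpenPartialHomeomorph X (Cn n)}

/-- The trace of the equation `Ric(ω) = ω + √-1 ∂∂̄f`. -/
theorem scalarCurvature_eq {f : X → ℝ} (hf : K.IsRicciPotential f) (x : X) :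
    K.scalarCurvature x = n + K.laplacian (fun y => (f y : ℂ)) x := by
  have hz := (chartAt (Cn n) x).map_source (mem_chart_source (Cn n) x)
  have he := chart_mem_atlas (Cn n) x
  rw [scalarCurvature, laplacian, ← hf.2 _ he _ hz, Matrix.mul_sub, Matrix.trace_sub,
    Matrix.nonsing_inv_mul _ (K.metric_det_ne_zero he hz).isUnit, Matrix.trace_one,
    Fintype.card_fin]
  ring

/-- In a chart the Hamiltonian equation reads `∂θ/∂z̄_k = ∑ vʲ g_{jk̄}`. -/
theorem dzbar_hamiltonian {v : ∀ x : X, CT n x} {θ : X → ℂ} (hθ : K.IsHamiltonian v θ)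
    (he : e ∈ atlas (Cn n) X) {z : Cn n} (hz : z ∈ e.target) (k : Fin n) :
    dzbar k (fun y => θ (e.symm y)) z = ∑ j, components v e z j * K.metric e z j k := by
  have h1 : K.hermAux e z (components v e z) (Pi.single k 1) =
      ∑ j, components v e z j * K.metric e z j k := by
    rw [K.hermAux_eq_sum he hz]
    refine Finset.sum_congr rfl fun j _ => ?_
    rw [Finset.sum_eq_single k]
    · simp
    · intro m _ hm
      simp [hm]
    · simp
  have h := hθ.2 (e.symm z) (chartPush e z (Pi.single k 1))
  rw [contract, dbar, ← chartPush_components v he hz, J_chartPush he hz, J_chartPush he hz,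
    ← localForm_apply, ← localForm_apply, diff_chartPush he hz hθ.1, diff_chartPush he hz hθ.1,
    K.localForm_I_left he hz, ← single_I_eq] at h
  have h' : (1 / 2 : ℂ) * ((localForm K.form e z ![components v e z, Pi.single k 1] : ℂ) -
      Complex.I * ((-localForm K.form e z ![components v e z, Pi.single k Complex.I] : ℝ) : ℂ)) =
      Complex.I * dzbar k (fun y => θ (e.symm y)) z := h
  rw [← h1, hermAux, ← single_I_eq]
  push_cast at h'
  linear_combination Complex.I * h' + (dzbar k (fun y => θ (e.symm y)) z - 1 / 2 *
    (localForm K.form e z ![components v e z, Pi.single k Complex.I] : ℂ)) * Complex.I_mul_I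

/-- `v(F) = ⟨∂F, ∂̄θ⟩` for the Hamiltonian function `θ` of `v`. -/
theorem along_eq_pairing {v : ∀ x : X, CT n x} {θ : X → ℂ} (hθ : K.IsHamiltonian v θ) {F : X → ℂ}
    (hF : ContMDiff 𝓘(ℝ, Cn n) 𝓘(ℝ, ℂ) ∞ F) : along v F = K.pairing F θ := by
  funext x
  have hxs := mem_chart_source (Cn n) x
  have he := chart_mem_atlas (Cn n) x
  set e := chartAt (Cn n) x
  have hz := e.map_source hxs
  set z := e x
  have hxz : x = e.symm z := (e.left_inv hxs).symm
  rw [hxz, along_symm_apply v he hz hF, K.pairing_symm_apply he hz hF hθ.1, Matrix.trace_mul_comm]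
  have hV (j : Fin n) : ∑ k, dzbar k (fun y => θ (e.symm y)) z * (K.metric e z)⁻¹ k j =
      components v e z j := by
    have h1 : Matrix.vecMul (components v e z) (K.metric e z) =
        fun k => dzbar k (fun y => θ (e.symm y)) z :=
      funext fun k => (K.dzbar_hamiltonian hθ he hz k).symm
    have h2 := congrArg (fun w => Matrix.vecMul w (K.metric e z)⁻¹ j) h1
    simp only [Matrix.vecMul_vecMul,
      Matrix.mul_nonsing_inv _ (K.metric_det_ne_zero he hz).isUnit, Matrix.vecMul_one] at h2
    exact h2.symm
  simp only [Matrix.trace, Matrix.diag, Matrix.mul_apply, gradMatrix, Matrix.of_apply, mul_assoc,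
    ← Finset.mul_sum, hV]
  exact Finset.sum_congr rfl fun j _ => mul_comm _ _

theorem contDiffOn_log_det (he : e ∈ atlas (Cn n) X) :
    ContDiffOn ℝ ∞ (fun y => (Real.log (K.metric e y).det.re : ℂ)) e.target :=
  Complex.ofRealCLM.contDiff.comp_contDiffOn
    ((Complex.reCLM.contDiff.comp_contDiffOn (K.contDiffOn_det_metric he)).log
      fun _ hy => (K.metric_det_re_pos he hy).ne')

/-- The logarithmic derivative of the volume density is `tr (g⁻¹ ∂g)`. -/
theorem wirtinger_log_det {s : ℂ} (he : e ∈ atlas (Cn n) X) {z : Cn n} (hz : z ∈ e.target)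
    (m : Fin n) : wirtinger s m (fun y => (Real.log (K.metric e y).det.re : ℂ)) z =
      ((K.metric e z)⁻¹ * wirtingerMatrix s m (K.metric e) z).trace := by
  have hd {φ : Cn n → ℂ} (h : ContDiffOn ℝ ∞ φ e.target) : DifferentiableAt ℝ φ z :=
    (h.contDiffAt (e.open_target.mem_nhds hz)).differentiableAt (by simp)
  have hexp : ∀ y ∈ e.target, Complex.exp (Real.log (K.metric e y).det.re : ℂ) =
      (K.metric e y).det := fun y hy => by
    rw [← Complex.ofReal_exp, Real.exp_log (K.metric_det_re_pos he hy),
      K.ofReal_metric_det_re he hy]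
  have h1 := wirtinger_cexp (s := s) (j := m) (hd (K.contDiffOn_log_det he))
  rw [hexp z hz, wirtinger_congr_of_eqOn e.open_target hexp hz,
    wirtinger_det_eq_mul_trace (fun j k => hd (K.contDiffOn_metric he j k))
      (K.metric_det_ne_zero he hz)] at h1
  exact (mul_left_cancel₀ (K.metric_det_ne_zero he hz) h1).symm

theorem contDiffOn_components {v : ∀ x : X, CT n x} (hv : IsHolomorphicField v) (i : X)
    (m : Fin n) : ContDiffOn ℝ ∞ (fun y => components v (chartAt (Cn n) i) y m)
      (chartAt (Cn n) i).target := by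
  have h := (contDiffOn_pi.1 (contDiffOn_components_holomorphic hv i)) m
  exact (h.restrict_scalars ℝ).of_le le_top

theorem dzbar_components {v : ∀ x : X, CT n x} (hv : IsHolomorphicField v) (i : X) (m l : Fin n)
    {z : Cn n} (hz : z ∈ (chartAt (Cn n) i).target) :
    dzbar l (fun y => components v (chartAt (Cn n) i) y m) z = 0 := by
  have h := (contDiffOn_pi.1 (contDiffOn_components_holomorphic hv i)) m
  exact dzbar_eq_zero_of_differentiableAt ((h.contDiffAt
    ((chartAt (Cn n) i).open_target.mem_nhds hz)).differentiableAt (by simp)) l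

/-- The Laplacian of a holomorphy potential is the divergence of the holomorphic field with
respect to the volume form: in a chart `Δθ = ∑ ∂vᵐ/∂z_m + ∑ vᵐ ∂(log det g)/∂z_m`. -/
theorem laplacian_hamiltonian {v : ∀ x : X, CT n x} (hv : IsHolomorphicField v) {θ : X → ℂ}
    (hθ : K.IsHamiltonian v θ) (i : X) {z : Cn n} (hz : z ∈ (chartAt (Cn n) i).target) :
    K.laplacian θ ((chartAt (Cn n) i).symm z) =
      ∑ m, (dz m (fun y => components v (chartAt (Cn n) i) y m) z +
        components v (chartAt (Cn n) i) z m *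
          dz m (fun y => (Real.log (K.metric (chartAt (Cn n) i) y).det.re : ℂ)) z) := by
  have he := chart_mem_atlas (Cn n) i
  have hV := contDiffOn_components hv i
  set e := chartAt (Cn n) i
  have hd {φ : Cn n → ℂ} (h : ContDiffOn ℝ ∞ φ e.target) : DifferentiableAt ℝ φ z :=
    (h.contDiffAt (e.open_target.mem_nhds hz)).differentiableAt (by simp)
  have hg := K.contDiffOn_metric he
  rw [K.laplacian_symm_apply he hz hθ.1]
  have h1 : ddbar (fun y => θ (e.symm y)) z =
      (Matrix.of fun j m => dz j (fun y => components v e y m) z) * K.metric e z +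
        Matrix.of fun j k => ∑ m, components v e z m * dz m (fun y => K.metric e y j k) z := by
    ext j k
    rw [ddbar, Matrix.of_apply, dz_eq_wirtinger, wirtinger_congr_of_eqOn e.open_target
      (fun y hy => K.dzbar_hamiltonian hθ he hy k) hz,
      wirtinger_sum fun m _ => (hd (hV m)).fun_mul (hd (hg m k)), Matrix.add_apply,
      Matrix.mul_apply, Matrix.of_apply, ← Finset.sum_add_distrib]
    refine Finset.sum_congr rfl fun m _ => ?_
    rw [wirtinger_mul (hd (hV m)) (hd (hg m k)), K.dz_metric_symm he hz, Matrix.of_apply,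
      dz_eq_wirtinger, dz_eq_wirtinger]
  rw [h1, Matrix.mul_add, Matrix.trace_add, Matrix.trace_mul_comm, Matrix.mul_assoc,
    Matrix.mul_nonsing_inv _ (K.metric_det_ne_zero he hz).isUnit, Matrix.mul_one,
    Finset.sum_add_distrib]
  congr 1
  simp only [dz_eq_wirtinger, K.wirtinger_log_det he hz, Matrix.trace, Matrix.diag,
    Matrix.mul_apply, wirtingerMatrix, Matrix.of_apply, Finset.mul_sum]
  conv_rhs => rw [Finset.sum_comm]
  refine Finset.sum_congr rfl fun k _ => ?_
  conv_rhs => rw [Finset.sum_comm]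
  exact Finset.sum_congr rfl fun j _ => Finset.sum_congr rfl fun m _ => by ring

/-- The function `Δθ + θ + v(f)` is holomorphic, hence constant: in a chart its `∂̄`-derivative is
the contraction of `v` with `∂∂̄ log det g + g + ∂∂̄f`, which vanishes by the equation of the Ricci
potential. -/
theorem exists_laplacian_add_eq_const [CompactSpace X] [ConnectedSpace X] {f : X → ℝ}
    (hf : K.IsRicciPotential f) {v : ∀ x : X, CT n x} (hv : IsHolomorphicField v) {θ : X → ℂ}
    (hθ : K.IsHamiltonian v θ) :
    ∃ c, ∀ x, K.laplacian θ x + θ x + along v (fun y => (f y : ℂ)) x = c := by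
  have hfc : ContMDiff 𝓘(ℝ, Cn n) 𝓘(ℝ, ℂ) ∞ (fun y => (f y : ℂ)) :=
    Complex.ofRealCLM.contDiff.comp_contMDiff hf.1
  refine exists_eq_const_of_differentiableAt_charts (n := n) fun i z hz => ?_
  have he := chart_mem_atlas (Cn n) i
  have hV := contDiffOn_components hv i
  have hVbar := fun m l (y : Cn n) (hy : y ∈ (chartAt (Cn n) i).target) =>
    dzbar_components hv i m l hy
  have hL := fun y (hy : y ∈ (chartAt (Cn n) i).target) => K.laplacian_hamiltonian hv hθ i hy
  set e := chartAt (Cn n) i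
  set V : Fin n → Cn n → ℂ := fun m y => components v e y m with hVdef
  set ℓ : Cn n → ℂ := fun y => (Real.log (K.metric e y).det.re : ℂ) with hℓ
  set fe : Cn n → ℂ := fun y => (f (e.symm y) : ℂ) with hfe
  have hU := e.open_target
  have hd {φ : Cn n → ℂ} (h : ContDiffOn ℝ ∞ φ e.target) : DifferentiableAt ℝ φ z :=
    (h.contDiffAt (hU.mem_nhds hz)).differentiableAt (by simp)
  have hℓs : ContDiffOn ℝ ∞ ℓ e.target := K.contDiffOn_log_det he
  have hfs : ContDiffOn ℝ ∞ fe e.target := contDiffOn_comp_symm he hfc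
  have hθs : ContDiffOn ℝ ∞ (fun y => θ (e.symm y)) e.target := contDiffOn_comp_symm he hθ.1
  have hw {φ : Cn n → ℂ} (h : ContDiffOn ℝ ∞ φ e.target) (m : Fin n) :
      ContDiffOn ℝ ∞ (dz m φ) e.target := by
    rw [dz_eq_wirtinger]; exact contDiffOn_wirtinger hU h
  have hS (m : Fin n) : ContDiffOn ℝ ∞ (fun y => dz m (V m) y + V m y * dz m ℓ y) e.target :=
    (hw (hV m) m).add ((hV m).mul (hw hℓs m))
  have hA (m : Fin n) : ContDiffOn ℝ ∞ (fun y => V m y * dz m fe y) e.target :=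
    (hV m).mul (hw hfs m)
  have hE : Set.EqOn (fun y => K.laplacian θ (e.symm y) + θ (e.symm y) +
      along v (fun y => (f y : ℂ)) (e.symm y)) (fun y =>
      ∑ m, (dz m (V m) y + V m y * dz m ℓ y) + θ (e.symm y) + ∑ m, V m y * dz m fe y) e.target :=
    fun y hy => by simp only [hL y hy, along_symm_apply v he hy hfc, hVdef, hfe, hℓ]
  have hsS : ContDiffOn ℝ ∞ (fun y => ∑ m, (dz m (V m) y + V m y * dz m ℓ y)) e.target :=
    ContDiffOn.sum fun m _ => hS m
  have hsA : ContDiffOn ℝ ∞ (fun y => ∑ m, V m y * dz m fe y) e.target :=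
    ContDiffOn.sum fun m _ => hA m
  have hEv := hE.eventuallyEq_of_mem (hU.mem_nhds hz)
  refine differentiableAt_of_dzbar_eq_zero (((hd hsS).add (hd hθs)).add (hd hsA)
    |>.congr_of_eventuallyEq hEv) fun l => ?_
  -- `∂̄` commutes with `∂` and annihilates the components of `v`
  have hcomm {φ : Cn n → ℂ} (h : ContDiffOn ℝ ∞ φ e.target) (m : Fin n) :
      dzbar l (dz m φ) z = ddbar φ z m l := by
    rw [ddbar, Matrix.of_apply, dz_eq_wirtinger, dz_eq_wirtinger, dzbar_eq_wirtinger,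
      dzbar_eq_wirtinger, wirtinger_comm hU h hz]
  have hVV (m : Fin n) : dzbar l (dz m (V m)) z = 0 := by
    rw [hcomm (hV m), ddbar, Matrix.of_apply, dz_eq_wirtinger,
      wirtinger_congr_of_eqOn hU (ψ := fun _ => 0) (fun y hy => hVbar m l y hy) hz, wirtinger_const]
  have hmul {φ : Cn n → ℂ} (h : ContDiffOn ℝ ∞ φ e.target) (m : Fin n) :
      dzbar l (fun y => V m y * dz m φ y) z = V m z * ddbar φ z m l := by
    rw [dzbar_eq_wirtinger, wirtinger_mul (hd (hV m)) (hd (hw h m)), ← dzbar_eq_wirtinger,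
      ← dzbar_eq_wirtinger, hcomm h, hVbar m l z hz, zero_mul, zero_add]
  have h1 (m : Fin n) : dzbar l (fun y => dz m (V m) y + V m y * dz m ℓ y) z =
      V m z * ddbar ℓ z m l := by
    rw [dzbar_eq_wirtinger, wirtinger_add (φ := dz m (V m)) (ψ := fun y => V m y * dz m ℓ y)
      (hd (hw (hV m) m)) (hd ((hV m).mul (hw hℓs m))), ← dzbar_eq_wirtinger, ← dzbar_eq_wirtinger,
      hVV, hmul hℓs, zero_add]
  rw [dzbar_eq_wirtinger, wirtinger_congr hEv, wirtinger_add ((hd hsS).fun_add (hd hθs)) (hd hsA),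
    wirtinger_add (hd hsS) (hd hθs), wirtinger_sum fun m _ => hd (hS m),
    wirtinger_sum fun m _ => hd (hA m)]
  simp only [← dzbar_eq_wirtinger, h1, hmul hfs, K.dzbar_hamiltonian hθ he hz]
  rw [← Finset.sum_add_distrib, ← Finset.sum_add_distrib]
  refine Finset.sum_eq_zero fun m _ => ?_
  have h2 := congrFun (congrFun (hf.2 e he z hz) m) l
  rw [Matrix.sub_apply, ricci, Matrix.neg_apply] at h2
  change -ddbar ℓ z m l - K.metric e z m l = ddbar fe z m l at h2
  change V m z * ddbar ℓ z m l + V m z * K.metric e z m l + V m z * ddbar fe z m l = 0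
  rw [← h2]; ring

end KahlerForm

end HamiltonianFields

/-! ### The weight of a metric on the anticanonical bundle -/

section AnticanonicalWeight

variable {n : ℕ} {X : Type*} [TopologicalSpace X] [ChartedSpace (Cn n) X]

/-- An alternating map in `n` variables on `ℂⁿ` is a multiple of the determinant. -/
theorem alternatingMap_apply_eq_det_smul {N : Type*} [AddCommGroup N] [Module ℂ N]
    (g : Cn n [⋀^Fin n]→ₗ[ℂ] N) (A : Matrix (Fin n) (Fin n) ℂ) :
    g (fun j => A.transpose j) = A.det • g (fun j => Pi.single j 1) := by
  have h : g = (LinearMap.toSpanSingleton ℂ N (g fun j => Pi.single j 1)).compAlternatingMap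
      Matrix.detRowAlternating := by
    refine Module.Basis.ext_alternating (Pi.basisFun ℂ (Fin n)) fun w hw => ?_
    let σ : Equiv.Perm (Fin n) := Equiv.ofBijective w hw.bijective_of_finite
    have hσ : (fun i => (Pi.basisFun ℂ (Fin n)) (w i)) =
        (fun j => (Pi.single j 1 : Cn n)) ∘ σ := by
      funext i
      simp [σ]
    rw [hσ, g.map_perm, AlternatingMap.map_perm]
    congr 1
    rw [LinearMap.compAlternatingMap_apply, LinearMap.toSpanSingleton_apply]
    have h1 : (Matrix.detRowAlternating fun j => (Pi.single j 1 : Cn n) : ℂ) = 1 := by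
      have h2 : (fun j => (Pi.single j 1 : Cn n)) = (1 : Matrix (Fin n) (Fin n) ℂ) := by
        ext i j
        rw [Matrix.one_apply, Pi.single_apply]
        simp only [eq_comm]
      rw [h2]
      exact Matrix.det_one
    rw [h1, one_smul]
  conv_lhs => rw [h]
  rw [LinearMap.compAlternatingMap_apply, LinearMap.toSpanSingleton_apply]
  congr 1
  exact A.det_transpose

variable [IsManifold 𝓘(ℂ, Cn n) ω X] {e : OpenPartialHomeomorph X (Cn n)}

/-- The derivative of an inverse chart as a complex linear map. -/
def chartPushLinear (he : e ∈ atlas (Cn n) X) {z : Cn n} (hz : z ∈ e.target) :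
    Cn n →ₗ[ℂ] CT n (e.symm z) where
  toFun w := toCT (chartPush e z w)
  map_add' a b := by rw [map_add]; rfl
  map_smul' c a := by rw [chartPush_smul he hz]; rfl

/-- A linear change of the coordinate frame multiplies its wedge by the determinant. -/
theorem wedge_chartPush (he : e ∈ atlas (Cn n) X) {z : Cn n} (hz : z ∈ e.target)
    (A : Matrix (Fin n) (Fin n) ℂ) :
    wedge (fun j => chartPush e z (A.transpose j)) = A.det • wedge (frame e z) :=
  alternatingMap_apply_eq_det_smul
    ((exteriorPower.ιMulti ℂ n).compLinearMap (chartPushLinear he hz)) A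

/-- The coordinate frame trivializes the anticanonical bundle: the determinant separates its wedge
from zero. -/
theorem wedge_frame_ne_zero (he : e ∈ atlas (Cn n) X) {z : Cn n} (hz : z ∈ e.target) :
    wedge (frame e z) ≠ 0 := by
  have hinj : Function.Injective (chartPushLinear he hz) := chartPush_injective he hz
  have : FiniteDimensional ℂ (CT n (e.symm z)) :=
    inferInstanceAs (FiniteDimensional ℂ (Cn n))
  let E : Cn n ≃ₗ[ℂ] CT n (e.symm z) :=
    LinearEquiv.ofInjectiveOfFinrankEq (chartPushLinear he hz) hinj rfl
  let F : CT n (e.symm z) [⋀^Fin n]→ₗ[ℂ] ℂ :=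
    (Matrix.detRowAlternating (R := ℂ) (n := Fin n)).compLinearMap (E.symm : _ →ₗ[ℂ] Cn n)
  intro h0
  have h1 : exteriorPower.alternatingMapLinearEquiv F (wedge (frame e z)) =
      F fun j => toCT (frame e z j) :=
    exteriorPower.alternatingMapLinearEquiv_apply_ιMulti F _
  rw [h0, map_zero] at h1
  have h2 : (F fun j => toCT (frame e z j)) = 1 := by
    have h3 (j : Fin n) : E.symm (toCT (frame e z j)) = Pi.single j 1 := by
      rw [LinearEquiv.symm_apply_eq]
      rfl
    have h4 : (fun j => (E.symm (toCT (frame e z j)) : Cn n)) =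
        (1 : Matrix (Fin n) (Fin n) ℂ) := by
      ext i j
      rw [h3, Matrix.one_apply, Pi.single_apply]
      simp only [eq_comm]
    change Matrix.det (fun j => (E.symm (toCT (frame e z j)) : Cn n)) = 1
    rw [h4, Matrix.det_one]
  exact zero_ne_one (h1.trans h2)

namespace AnticanonicalMetric

variable (h : AnticanonicalMetric n X)

theorem weight_pos (he : e ∈ atlas (Cn n) X) {z : Cn n} (hz : z ∈ e.target) :
    0 < h.weight e z := h.pos _ _ (wedge_frame_ne_zero he hz)

omit [IsManifold 𝓘(ℂ, Cn n) ω X] in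
theorem inner_self_eq (x : X) (s : Anticanonical n x) : h.inner x s s = ((h.inner x s s).re : ℂ) :=
  (Complex.conj_eq_iff_re.1 (h.conj_symm x s s)).symm

/-- The weight changes by `|det ∂Φ|²` under a change of chart `Φ`. -/
theorem weight_change {e' : OpenPartialHomeomorph X (Cn n)} (he : e ∈ atlas (Cn n) X)
    (he' : e' ∈ atlas (Cn n) X) {z : Cn n} (hz : z ∈ (e.symm ≫ₕ e').source) :
    h.weight e z = Complex.normSq (jacobian (fun y => e' (e.symm y)) z).det *
      h.weight e' (e' (e.symm z)) := by
  have hz' : z ∈ e.target ∧ e.symm z ∈ e'.source := by simpa using hz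
  have h1 : h.weight e z = (h.inner (e'.symm (e' (e.symm z)))
      (wedge fun j => chartPush e' (e' (e.symm z))
        ((jacobian (fun y => e' (e.symm y)) z).transpose j))
      (wedge fun j => chartPush e' (e' (e.symm z))
        ((jacobian (fun y => e' (e.symm y)) z).transpose j))).re := by
    have hA (j : Fin n) : (jacobian (fun y => e' (e.symm y)) z).transpose j =
        fderiv ℂ (fun y => e' (e.symm y)) z (Pi.single j 1) :=
      funext fun l => jacobian_apply _ _ _ _
    simp only [hA]
    exact congrArg (fun p : Σ x : X, Cn n → RT n x =>
      (h.inner p.1 (wedge fun j => p.2 (Pi.single j 1))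
        (wedge fun j => p.2 (Pi.single j 1))).re) (chartPush_change he he' hz)
  have h2 (x : X) (c : ℂ) (s : Anticanonical n x) :
      (h.inner x (c • s) (c • s)).re = Complex.normSq c * (h.inner x s s).re := by
    have h3 : h.inner x (c • s) (c • s) = (starRingEnd ℂ c * c) * h.inner x s s := by
      rw [map_smul (h.inner x (c • s)), LinearMap.map_smulₛₗ, LinearMap.smul_apply, smul_eq_mul,
        smul_eq_mul]
      ring
    rw [h3, ← Complex.normSq_eq_conj_mul_self, Complex.re_ofReal_mul]
  rw [h1, wedge_chartPush he' (e'.map_source hz'.2), h2]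
  rfl

omit [IsManifold 𝓘(ℂ, Cn n) ω X] in
theorem contDiffOn_weight (he : e ∈ atlas (Cn n) X) :
    ContDiffOn ℝ ∞ (h.weight e) e.target :=
  Complex.reCLM.contDiff.comp_contDiffOn (h.smooth e he)

end AnticanonicalMetric

/-- A function which is smooth in all preferred charts is smooth. -/
theorem contMDiff_of_contDiffOn_charts {F : X → ℂ}
    (hF : ∀ i : X, ContDiffOn ℝ ∞ (fun z => F ((chartAt (Cn n) i).symm z))
      (chartAt (Cn n) i).target) : ContMDiff 𝓘(ℝ, Cn n) 𝓘(ℝ, ℂ) ∞ F := by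
  have := isManifold_real n X
  intro x
  have hx := mem_chart_source (Cn n) x
  have he := chart_mem_atlas (Cn n) x
  have h := hF x
  set e := chartAt (Cn n) x
  have h1 : ContMDiffAt 𝓘(ℝ, Cn n) 𝓘(ℝ, ℂ) ∞ (fun z => F (e.symm z)) (e x) :=
    (h.contDiffAt (e.open_target.mem_nhds (e.map_source hx))).contMDiffAt
  have h2 : ContMDiffAt 𝓘(ℝ, Cn n) 𝓘(ℝ, Cn n) ∞ e x :=
    (contMDiffOn_of_mem_maximalAtlas (IsManifold.subset_maximalAtlas he)).contMDiffAt
      (e.open_source.mem_nhds hx)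
  refine (h1.comp x h2).congr_of_eventuallyEq (Filter.eventuallyEq_of_mem
    (e.open_source.mem_nhds hx) fun y hy => ?_)
  simp only [Function.comp_apply, e.left_inv hy]

namespace KahlerForm

open scoped ComplexOrder in
/-- A real function with vanishing complex Hessian on a compact connected Kähler manifold is
constant: the energy `∫ ⟨∂u, ∂̄u⟩ ωⁿ = -∫ u Δu ωⁿ` vanishes. -/
theorem exists_eq_const_of_ddbar_eq_zero [CompactSpace X] [T2Space X] [ConnectedSpace X]
    (K : KahlerForm n X) {u : X → ℝ} (hu : ContMDiff 𝓘(ℝ, Cn n) 𝓘(ℝ, ℂ) ∞ fun x => (u x : ℂ))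
    (h0 : ∀ i : X, ∀ z ∈ (chartAt (Cn n) i).target,
      ddbar (fun y => (u ((chartAt (Cn n) i).symm y) : ℂ)) z = 0) : ∃ c, ∀ x, u x = c := by
  set U : X → ℂ := fun x => (u x : ℂ) with hU
  have hlap : K.laplacian U = fun _ => 0 := by
    funext x
    rw [laplacian, hU, h0 x _ ((chartAt (Cn n) x).map_source (mem_chart_source (Cn n) x)),
      Matrix.mul_zero, Matrix.trace_zero]
  have hI : K.volIntegral (K.pairing U U) = 0 := by
    have h1 := K.volIntegral_mul_laplacian hu hu
    have h2 := K.volIntegral_const_mul 0 fun _ => 0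
    simp only [hlap, mul_zero] at h1
    simp only [mul_zero, zero_mul] at h2
    rw [h2] at h1
    exact neg_eq_zero.1 h1.symm
  -- the energy density is the norm of `∂u` for the inverse metric
  have hp (i : X) (z : Cn n) (hz : z ∈ (chartAt (Cn n) i).target) :
      K.pairing U U ((chartAt (Cn n) i).symm z) =
      star (fun j => star (dz j (fun y => U ((chartAt (Cn n) i).symm y)) z)) ⬝ᵥ
        ((K.metric (chartAt (Cn n) i) z)⁻¹.transpose.mulVec
          fun j => star (dz j (fun y => U ((chartAt (Cn n) i).symm y)) z)) := by
    have he := chart_mem_atlas (Cn n) i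
    rw [K.pairing_symm_apply he hz hu hu]
    set e := chartAt (Cn n) i with hedef
    have hb (k : Fin n) := dzbar_ofReal (fun y => u (e.symm y))
      (differentiableAt_comp_symm he hz hu) k
    simp only [Matrix.trace, Matrix.diag, Matrix.mul_apply, gradMatrix,
      Matrix.of_apply, dotProduct, Matrix.mulVec, Matrix.transpose_apply, Pi.star_apply, star_star,
      Finset.mul_sum]
    rw [Finset.sum_comm]
    refine Finset.sum_congr rfl fun j _ => Finset.sum_congr rfl fun k _ => ?_
    rw [hU]
    simp only [hb]
    ring
  have hpd (i : X) (z : Cn n) (hz : z ∈ (chartAt (Cn n) i).target) :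
      (K.metric (chartAt (Cn n) i) z)⁻¹.transpose.PosDef :=
    (K.metric_posDef (chart_mem_atlas (Cn n) i) hz).inv.transpose
  have hnn (x : X) : 0 ≤ K.pairing U U x := by
    have hz := (chartAt (Cn n) x).map_source (mem_chart_source (Cn n) x)
    have := (hpd x _ hz).posSemidef.dotProduct_mulVec_nonneg
      (fun j => star (dz j (fun y => U ((chartAt (Cn n) x).symm y)) (chartAt (Cn n) x x)))
    rwa [← hp x _ hz, (chartAt (Cn n) x).left_inv (mem_chart_source (Cn n) x)] at this
  have hre (x : X) : ((K.pairing U U x).re : ℂ) = K.pairing U U x :=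
    Complex.ext rfl (Complex.nonneg_iff.1 (hnn x)).2
  have hzero (x : X) : K.pairing U U x = 0 := by
    rw [← hre x, K.eq_zero_of_volIntegral_eq_zero (φ := fun x => (K.pairing U U x).re)
      (Complex.continuous_re.comp (K.continuous_pairing hu hu))
      (fun y => (Complex.nonneg_iff.1 (hnn y)).1) (by simpa only [hre] using hI) x,
      Complex.ofReal_zero]
  have hdz (i : X) (z : Cn n) (hz : z ∈ (chartAt (Cn n) i).target) (j : Fin n) :
      dz j (fun y => U ((chartAt (Cn n) i).symm y)) z = 0 := by
    by_contra hne
    have hv : (fun j => star (dz j (fun y => U ((chartAt (Cn n) i).symm y)) z)) ≠ 0 :=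
      fun h => hne (by simpa using congrFun h j)
    have := (hpd i z hz).dotProduct_mulVec_pos hv
    rw [← hp i z hz, hzero] at this
    exact lt_irrefl _ this
  -- a real function with `∂u = 0` is holomorphic
  obtain ⟨c, hc⟩ := exists_eq_const_of_differentiableAt_charts (F := U) fun i z hz => by
    have hd := differentiableAt_comp_symm (chart_mem_atlas (Cn n) i) hz hu
    refine differentiableAt_of_dzbar_eq_zero hd fun j => ?_
    have h1 := hdz i z hz j
    exact (dzbar_ofReal (fun y => u ((chartAt (Cn n) i).symm y)) hd j).trans
      ((congrArg star h1).trans (star_zero ℂ))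
  exact ⟨c.re, fun x => by rw [← hc x, hU, Complex.ofReal_re]⟩

end KahlerForm

end AnticanonicalWeight

/-! ### The two volume forms and the integral identities -/

section Comparison

variable {n : ℕ} {X : Type*} [TopologicalSpace X] [ChartedSpace (Cn n) X]

theorem ddbar_congr_of_eqOn {φ ψ : Cn n → ℂ} {U : Set (Cn n)} (hU : IsOpen U)
    (h : Set.EqOn φ ψ U) {z : Cn n} (hz : z ∈ U) : ddbar φ z = ddbar ψ z := by
  ext j k
  simp only [ddbar, Matrix.of_apply, dz_eq_wirtinger]
  exact wirtinger_congr_of_eqOn hU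
    (fun y hy => wirtinger_congr_of_eqOn (s := Complex.I) (j := k) hU h hy) hz

theorem ddbar_sub {φ ψ : Cn n → ℂ} {U : Set (Cn n)} (hU : IsOpen U) (hφ : ContDiffOn ℝ ∞ φ U)
    (hψ : ContDiffOn ℝ ∞ ψ U) {z : Cn n} (hz : z ∈ U) :
    ddbar (fun y => φ y - ψ y) z = ddbar φ z - ddbar ψ z := by
  have hd {χ : Cn n → ℂ} (h : ContDiffOn ℝ ∞ χ U) {y : Cn n} (hy : y ∈ U) :
      DifferentiableAt ℝ χ y :=
    (h.contDiffAt (hU.mem_nhds hy)).differentiableAt (by simp)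
  ext j k
  simp only [ddbar, Matrix.of_apply, Matrix.sub_apply, dz_eq_wirtinger]
  rw [wirtinger_congr_of_eqOn hU (φ := dzbar k fun y => φ y - ψ y)
    (ψ := fun y => dzbar k φ y - dzbar k ψ y)
    (fun y hy => wirtinger_sub (s := Complex.I) (hd hφ hy) (hd hψ hy)) hz]
  exact wirtinger_sub (hd (contDiffOn_wirtinger hU hφ) hz) (hd (contDiffOn_wirtinger hU hψ) hz)

variable [IsManifold 𝓘(ℂ, Cn n) ω X]

/-- The integral of a top form depends only on its values on the coordinate frames. -/
theorem integral_congr_frame [T2Space X] [CompactSpace X] {η η' : TopForm n X}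
    (h : ∀ i : X, ∀ z ∈ (chartAt (Cn n) i).target,
      η ((chartAt (Cn n) i).symm z) (frame (chartAt (Cn n) i) z) =
        η' ((chartAt (Cn n) i).symm z) (frame (chartAt (Cn n) i) z)) :
    integral η = integral η' :=
  finsum_congr fun i => setIntegral_congr_fun (chartAt (Cn n) i).open_target.measurableSet
    fun z hz => by simp only [h i z hz]

omit [IsManifold 𝓘(ℂ, Cn n) ω X] in
theorem along_const (v : ∀ x : X, CT n x) (c : ℂ) : along v (fun _ => c) = fun _ => 0 := by
  funext x
  have : diff (n := n) (fun _ : X => c) x = 0 := mfderiv_const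
  simp [along, this]

omit [IsManifold 𝓘(ℂ, Cn n) ω X] in
theorem contMDiff_cexp {F : X → ℂ} (hF : ContMDiff 𝓘(ℝ, Cn n) 𝓘(ℝ, ℂ) ∞ F) :
    ContMDiff 𝓘(ℝ, Cn n) 𝓘(ℝ, ℂ) ∞ (fun x => Complex.exp (F x)) :=
  Complex.contDiff_exp.comp_contMDiff hF

theorem along_cexp (v : ∀ x : X, CT n x) {F : X → ℂ} (hF : ContMDiff 𝓘(ℝ, Cn n) 𝓘(ℝ, ℂ) ∞ F)
    (x : X) : along v (fun y => Complex.exp (F y)) x = Complex.exp (F x) * along v F x := by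
  have hx := mem_chart_source (Cn n) x
  have he := chart_mem_atlas (Cn n) x
  set e := chartAt (Cn n) x
  have hz := e.map_source hx
  have h1 := along_symm_apply v he hz (contMDiff_cexp hF)
  have h2 := along_symm_apply v he hz hF
  rw [e.left_inv hx] at h1 h2
  rw [h1, h2, Finset.mul_sum]
  refine Finset.sum_congr rfl fun l _ => ?_
  rw [dz_eq_wirtinger, dz_eq_wirtinger, wirtinger_cexp (differentiableAt_comp_symm he hz hF),
    e.left_inv hx]
  ring

namespace AnticanonicalMetric

variable (h : AnticanonicalMetric n X) (K : KahlerForm n X)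

/-- The function `log (V / det g)`, computed in the preferred chart at the point.  Up to the
constant `log n!` it is the logarithm of the ratio of `Ω_h` and `ωⁿ`. -/
def logRatio (x : X) : ℝ :=
  Real.log (h.weight (chartAt (Cn n) x) (chartAt (Cn n) x x)) -
    Real.log (K.metric (chartAt (Cn n) x) (chartAt (Cn n) x x)).det.re

/-- `logRatio` can be computed in any chart, since `V` and `det g` change by the same factor. -/
theorem logRatio_symm_apply {e : OpenPartialHomeomorph X (Cn n)} (he : e ∈ atlas (Cn n) X)
    {z : Cn n} (hz : z ∈ e.target) :
    h.logRatio K (e.symm z) =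
      Real.log (h.weight e z) - Real.log (K.metric e z).det.re := by
  rw [logRatio]
  set e' := chartAt (Cn n) (e.symm z) with he'
  have he'a : e' ∈ atlas (Cn n) X := chart_mem_atlas _ _
  have hz' : z ∈ (e.symm ≫ₕ e').source := by simp [hz, he']
  have hzt : e' (e.symm z) ∈ e'.target := e'.map_source (mem_chart_source (Cn n) _)
  have h1 := h.weight_change he he'a hz'
  have h2 := congrArg Complex.re (K.metric_det_change he he'a hz')
  rw [Complex.re_ofReal_mul] at h2
  have hw := h.weight_pos he hz
  have hw' := h.weight_pos he'a hzt
  have hd' := K.metric_det_re_pos he'a hzt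
  have hc : Complex.normSq (jacobian (fun y => e' (e.symm y)) z).det ≠ 0 := fun h0 => by
    rw [h1, h0, zero_mul] at hw
    exact lt_irrefl _ hw
  rw [h1, h2, Real.log_mul hc hw'.ne', Real.log_mul hc hd'.ne']
  ring

/-- If `Ric(ω) - ω = √-1 ∂∂̄f` and `h` has curvature `ω`, then `Ω_h` is a constant multiple of
`e^f ωⁿ`: the logarithm of the quotient has vanishing complex Hessian. -/
theorem exists_logRatio_eq [CompactSpace X] [T2Space X] [ConnectedSpace X] {f : X → ℝ}
    (hf : K.IsRicciPotential f) (hh : h.HasCurvature K) :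
    ∃ c, ∀ x, h.logRatio K x = f x + c := by
  have hfc : ContMDiff 𝓘(ℝ, Cn n) 𝓘(ℝ, ℂ) ∞ (fun y => (f y : ℂ)) :=
    Complex.ofRealCLM.contDiff.comp_contMDiff hf.1
  have hW {e : OpenPartialHomeomorph X (Cn n)} (he : e ∈ atlas (Cn n) X) :
      ContDiffOn ℝ ∞ (fun y => (Real.log (h.weight e y) : ℂ)) e.target :=
    Complex.ofRealCLM.contDiff.comp_contDiffOn
      ((h.contDiffOn_weight he).log fun y hy => (h.weight_pos he hy).ne')
  have hu {e : OpenPartialHomeomorph X (Cn n)} (he : e ∈ atlas (Cn n) X) :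
      Set.EqOn (fun y => ((h.logRatio K (e.symm y) - f (e.symm y) : ℝ) : ℂ))
        (fun y => ((Real.log (h.weight e y) : ℂ) - (Real.log (K.metric e y).det.re : ℂ)) -
          (f (e.symm y) : ℂ)) e.target := fun y hy => by
    simp only [h.logRatio_symm_apply K he hy, Complex.ofReal_sub]
  obtain ⟨c, hc⟩ := K.exists_eq_const_of_ddbar_eq_zero
    (u := fun x => h.logRatio K x - f x)
    (contMDiff_of_contDiffOn_charts fun i => by
      have he := chart_mem_atlas (Cn n) i
      exact (((hW he).sub (K.contDiffOn_log_det he)).sub (contDiffOn_comp_symm he hfc)).congr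
        (hu he)) fun i z hz => by
      have he := chart_mem_atlas (Cn n) i
      set e := chartAt (Cn n) i
      have h2 := hh e he z hz
      have h3 := hf.2 e he z hz
      rw [curvature, neg_eq_iff_eq_neg] at h2
      rw [KahlerForm.ricci] at h3
      rw [ddbar_congr_of_eqOn e.open_target (hu he) hz, ddbar_sub e.open_target
        ((hW he).sub (K.contDiffOn_log_det he)) (contDiffOn_comp_symm he hfc) hz,
        ddbar_sub e.open_target (hW he) (K.contDiffOn_log_det he) hz, ← h3, h2]
      abel
  exact ⟨c, fun x => by rw [← hc x]; ring⟩

/-- On coordinate frames `Ω_h` is a constant multiple of `e^f ωⁿ`. -/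
theorem exists_volume_frame_eq [CompactSpace X] [T2Space X] [ConnectedSpace X] {f : X → ℝ}
    (hf : K.IsRicciPotential f) (hh : h.HasCurvature K) :
    ∃ κ : ℂ, κ ≠ 0 ∧ ∀ i : X, ∀ z ∈ (chartAt (Cn n) i).target,
      h.volume ((chartAt (Cn n) i).symm z) (frame (chartAt (Cn n) i) z) =
        κ * fmul (fun x => (Real.exp (f x) : ℂ)) K.volume ((chartAt (Cn n) i).symm z)
          (frame (chartAt (Cn n) i) z) := by
  obtain ⟨c, hc⟩ := h.exists_logRatio_eq K hf hh
  have hn : (n.factorial : ℂ) ≠ 0 := Nat.cast_ne_zero.2 n.factorial_ne_zero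
  refine ⟨(Real.exp c : ℂ) / n.factorial,
    div_ne_zero (Complex.ofReal_ne_zero.2 (Real.exp_pos c).ne') hn, fun i z hz => ?_⟩
  have he := chart_mem_atlas (Cn n) i
  set e := chartAt (Cn n) i
  have h1 : h.weight e z = Real.exp (f (e.symm z)) * Real.exp c * (K.metric e z).det.re := by
    have h2 := hc (e.symm z)
    rw [h.logRatio_symm_apply K he hz, sub_eq_iff_eq_add] at h2
    rw [← Real.exp_log (h.weight_pos he hz), h2, Real.exp_add, Real.exp_add,
      Real.exp_log (K.metric_det_re_pos he hz)]
  have h3 : h.inner (e.symm z) (wedge (frame e z)) (wedge (frame e z)) = (h.weight e z : ℂ) :=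
    h.inner_self_eq _ _
  have h4 : (K.hermMatrix (e.symm z) (frame e z)).det = ((K.metric e z).det.re : ℂ) :=
    (K.ofReal_metric_det_re he hz).symm
  rw [volume, fmul, KahlerForm.volume, h3, h4, h1]
  push_cast
  field_simp

end AnticanonicalMetric

namespace KahlerForm

variable (K : KahlerForm n X) [CompactSpace X] [T2Space X]

/-- `∫ v(f) ωⁿ = -∫ θ S(ω) ωⁿ`: since `S(ω) = n + Δf`, this is integration by parts. -/
theorem volIntegral_along_eq_neg_scalarCurvature {f : X → ℝ} (hf : K.IsRicciPotential f)
    {v : ∀ x : X, CT n x} {θ : X → ℂ} (hθ : K.IsHamiltonian v θ)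
    (hθ_mean : K.volIntegral θ = 0) :
    K.volIntegral (along v fun x => (f x : ℂ)) =
      -K.volIntegral (fun x => θ x * K.scalarCurvature x) := by
  have hfc : ContMDiff 𝓘(ℝ, Cn n) 𝓘(ℝ, ℂ) ∞ (fun y => (f y : ℂ)) :=
    Complex.ofRealCLM.contDiff.comp_contMDiff hf.1
  have h1 : (fun x => θ x * K.scalarCurvature x) = fun x =>
      (n : ℂ) * θ x + θ x * K.laplacian (fun y => (f y : ℂ)) x := by
    funext x
    rw [K.scalarCurvature_eq hf]
    ring
  rw [h1, K.volIntegral_add (F := fun x => (n : ℂ) * θ x)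
    (continuous_const.mul hθ.1.continuous)
    (G := fun x => θ x * K.laplacian (fun y => (f y : ℂ)) x)
    (hθ.1.continuous.mul (K.continuous_laplacian hfc)), K.volIntegral_const_mul, hθ_mean,
    mul_zero, zero_add, K.volIntegral_mul_laplacian' hθ.1 hfc, neg_neg,
    K.along_eq_pairing hθ hfc]

/-- `∫ v(f) ωⁿ = ∫ θ e^f ωⁿ`: the function `Δθ + θ + v(f)` is a constant `c`, and integrating it
against `ωⁿ` and against `e^f ωⁿ` shows that both sides are `c ∫ ωⁿ`. -/
theorem volIntegral_along_eq_volIntegral_mul_exp [ConnectedSpace X] {f : X → ℝ}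
    (hf : K.IsRicciPotential f)
    (hfC : K.volIntegral (fun x => (Real.exp (f x) : ℂ)) = K.volIntegral fun _ => 1)
    {v : ∀ x : X, CT n x} (hv : IsHolomorphicField v) {θ : X → ℂ} (hθ : K.IsHamiltonian v θ)
    (hθ_mean : K.volIntegral θ = 0) :
    K.volIntegral (along v fun x => (f x : ℂ)) =
      K.volIntegral (fun x => θ x * (Real.exp (f x) : ℂ)) := by
  have hfc : ContMDiff 𝓘(ℝ, Cn n) 𝓘(ℝ, ℂ) ∞ (fun y => (f y : ℂ)) :=
    Complex.ofRealCLM.contDiff.comp_contMDiff hf.1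
  have hE : ContMDiff 𝓘(ℝ, Cn n) 𝓘(ℝ, ℂ) ∞ (fun y => Complex.exp (f y : ℂ)) :=
    contMDiff_cexp hfc
  have hθc := hθ.1.continuous
  have hΔ := K.continuous_laplacian hθ.1
  have hv_cont : Continuous (along v fun x => (f x : ℂ)) := by
    rw [K.along_eq_pairing hθ hfc]
    exact K.continuous_pairing hfc hθ.1
  have h0 : K.volIntegral (fun _ => 0) = 0 := by
    simpa using K.volIntegral_const_mul 0 fun _ => 0
  obtain ⟨c, hc⟩ := K.exists_laplacian_add_eq_const hf hv hθ
  -- integration by parts against a smooth weight `G`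
  have key {G : X → ℂ} (hG : ContMDiff 𝓘(ℝ, Cn n) 𝓘(ℝ, ℂ) ∞ G) :
      c * K.volIntegral G = -K.volIntegral (along v G) + K.volIntegral (fun x => θ x * G x) +
        K.volIntegral (fun x => G x * along v (fun y => (f y : ℂ)) x) := by
    rw [K.along_eq_pairing hθ hG, ← K.volIntegral_mul_laplacian hG hθ.1,
      ← K.volIntegral_add (F := fun x => G x * K.laplacian θ x) (G := fun x => θ x * G x)
        (hG.continuous.mul hΔ) (hθc.mul hG.continuous),
      ← K.volIntegral_add (F := fun x => G x * K.laplacian θ x + θ x * G x)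
        (G := fun x => G x * along v (fun y => (f y : ℂ)) x)
        ((hG.continuous.mul hΔ).add (hθc.mul hG.continuous)) (hG.continuous.mul hv_cont),
      ← K.volIntegral_const_mul]
    congr 1
    funext x
    rw [← hc x]
    ring
  have h1 := key (G := fun _ => 1) contMDiff_const
  have h2 := key hE
  have h3 : along v (fun y => Complex.exp (f y : ℂ)) =
      fun x => Complex.exp (f x : ℂ) * along v (fun y => (f y : ℂ)) x :=
    funext fun x => along_cexp v hfc x
  simp only [mul_one, one_mul, along_const, h0, hθ_mean, neg_zero, zero_add] at h1
  rw [h3] at h2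
  simp only [← Complex.ofReal_exp] at h2
  rw [hfC, h1] at h2
  rw [h2]
  ring

end KahlerForm

end Comparison

end FutakiKE

end

open FutakiKE in
theorem mainTheorem6 (n : ℕ) (X : Type*) [TopologicalSpace X] [T2Space X] [CompactSpace X]
    [ConnectedSpace X] [ChartedSpace (Cn n) X] [IsManifold 𝓘(ℂ, Cn n) ω X]
    (K : KahlerForm n X) (f : X → ℝ) (hf : K.IsRicciPotential f) (C : ℝ)
    (hfC : integral (fmul (fun x => (Real.exp (f x) : ℂ)) K.volume) = (C : ℂ))
    (hC : integral K.volume = (C : ℂ))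
    (v : ∀ x : X, CT n x) (hv : IsHolomorphicField v)
    (θ : X → ℂ) (hθ : K.IsHamiltonian v θ) (hθ_mean : integral (fmul θ K.volume) = 0)
    (h : AnticanonicalMetric n X) (hh : h.HasCurvature K) :
    integral (fmul (along v fun x => (f x : ℂ)) K.volume) =
        -integral (fmul θ (fmul K.scalarCurvature K.volume)) ∧
      integral (fmul (along v fun x => (f x : ℂ)) K.volume) =
        (C : ℂ) * integral
          (fmul θ ((integral h.volume)⁻¹ • h.volume - (C : ℂ)⁻¹ • K.volume)) := by
  change K.volIntegral _ = (C : ℂ) at hfC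
  change K.volIntegral θ = 0 at hθ_mean
  have hvol : K.volIntegral (fun _ => 1) = (C : ℂ) := by
    rw [← hC]
    exact integral_congr_frame fun i z _ => one_mul _
  have hE : Continuous fun x => (Real.exp (f x) : ℂ) :=
    Complex.continuous_ofReal.comp (Real.continuous_exp.comp hf.1.continuous)
  have h1 := K.volIntegral_along_eq_neg_scalarCurvature hf hθ hθ_mean
  have h2 := K.volIntegral_along_eq_volIntegral_mul_exp hf (hfC.trans hvol.symm) hv hθ hθ_mean
  refine ⟨h1.trans (congrArg _ (integral_congr_frame fun i z _ => mul_assoc _ _ _)), ?_⟩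
  obtain ⟨κ, hκ, hΩ⟩ := h.exists_volume_frame_eq K hf hh
  -- up to the factor `κ`, which the normalisation cancels, `Ω_h` is `e^f ωⁿ`
  have h3 : integral h.volume = κ * C := by
    rw [← hfC, ← K.volIntegral_const_mul]
    exact integral_congr_frame fun i z hz => (hΩ i z hz).trans (mul_assoc _ _ _).symm
  have h4 : integral (fmul θ ((integral h.volume)⁻¹ • h.volume - (C : ℂ)⁻¹ • K.volume)) =
      (C : ℂ)⁻¹ * K.volIntegral fun x => θ x * (Real.exp (f x) : ℂ) := by
    have h5 : (C : ℂ)⁻¹ * K.volIntegral (fun x => θ x * (Real.exp (f x) : ℂ)) =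
        K.volIntegral fun x => (C : ℂ)⁻¹ * (θ x * (Real.exp (f x) : ℂ)) + -(C : ℂ)⁻¹ * θ x := by
      rw [K.volIntegral_add (F := fun x => (C : ℂ)⁻¹ * (θ x * (Real.exp (f x) : ℂ)))
        (G := fun x => -(C : ℂ)⁻¹ * θ x) (continuous_const.mul (hθ.1.continuous.mul hE))
        (continuous_const.mul hθ.1.continuous), K.volIntegral_const_mul, K.volIntegral_const_mul,
        hθ_mean, mul_zero, add_zero]
    rw [h5, h3]
    refine integral_congr_frame fun i z hz => ?_
    simp only [fmul, Pi.sub_apply, Pi.smul_apply, smul_eq_mul]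
    rw [hΩ i z hz, mul_inv, fmul]
    field_simp
    ring
  -- `X` is nonempty, so its volume does not vanish
  have hC0 : (C : ℂ) ≠ 0 := fun h0 => one_ne_zero <|
    K.eq_zero_of_volIntegral_eq_zero (φ := fun _ => 1) continuous_const (fun _ => zero_le_one)
      (by simpa using hvol.trans h0) (Classical.arbitrary X)
  rw [h4]
  exact h2.trans (mul_inv_cancel_left₀ hC0 _).symm
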